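/- Let $\kappa,\sigma,\nu,\lambda>0$, $T\ge 1/\lambda$, $y_0\in\mathbb R$, $\mu\in L^1(0,T)$ deterministic and $z_0\in L^1(0,1)$. On a probability space let $W$ be a Brownian motion, $N$ a homogeneous Poisson process with intensity $\nu$, independent of $W$, and $\gamma_1,\gamma_2,\dots$ i.i.d. square-integrable jump heights with mean $\bar\gamma$, independent of $(W,N)$ ($\gamma_i$ is the height of the $i$-th jump). Let the demand $Y$ solve on $[0,T]$ $$dY_t=\kappa(\mu(t)-Y_t)\,dt+\sigma\,dW_t+\gamma_t\,dN_t,\quad Y_0=y_0,\qquad\text{i.e.}\quad Y_t=y_0+\int_0^t\kappa(\mu(s)-Y_s)\,ds+\sigma W_t+\sum_{i=1}^{N_t}\gamma_i ,$$ and let $\mathcal F_t=\sigma(Y_s;\,0\le s\le t)$. A control $u$ is a square-integrable process on $[0,T-1/\lambda]$. It determines the (weak) solution $z$ of $z_t+\lambda z_x=0$ on $(0,1)\times(0,T)$, $z(x,0)=z_0(x)$, with inflow $z(0,t)=u(t)$ (and inflow $0$ for $t>T-1/\lambda$), and the outflow $y(s)=z(1,s)$. Given an information level $(\mathcal G_t)_{0\le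 t\le T-1/\lambda}$, $u$ is admissible if $u(t)$ is $\mathcal G_t$-measurable for every $t$; it is optimal if it minimizes $$\int_{1/\lambda}^T\mathbb E\big[(Y_s-y(s))^2\big]\,ds$$ among all admissible controls. Then $Y_t$ is square-integrable for every $t\in[0,T]$, and in each of the following three cases the given process $u^*$ is an optimal control, it is the only one up to equality $dt\otimes\mathbb P$-almost everywhere, and $u^*(t)=\mathbb E[Y_{t+1/\lambda}\mid\mathcal G_t]$ almost surely for every $t\in[0,T-1/\lambda]$. 1. (CM1, no updates) $\mathcal G_t=\mathcal F_0$: $$u^*(t)=e^{-\kappa(t+1/\lambda)}y_0+\kappa\int_0^{t+1/\lambda}e^{-\kappa(t+1/\lambda-s)}\mu(s)\,ds+\frac{\bar\gamma\nu}{\kappa}\big(1-e^{-\kappa(t+1/\lambda)}\big).$$ 2. (CM2, regular updates) For any $\Delta>0$ and $\hat t_i=i\Delta$, $i=0,1,2,\dots$: $\mathcal G_t=\mathcal F_{\hat t_i}$ for $t\in[\hat t_i,\hat t_{i+1})$: $$u^*(t)=e^{-\kappa(t+1/\lambda-\hat t_i)}Y_{\hat t_i}+\kappa\int_{\hat t_i}^{t+1/\lambda}e^{-\kappa(t+1/\lambda-s)}\mu(s)\,ds+\frac{\bar\gamma\nu}{\kappa}\big(1-e^{-\kappa(t+1/\lambda-\hat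 t_i)}\big),\quad t\in[\hat t_i,\hat t_{i+1}).$$ 3. (CM3, idealized) $\mathcal G_t=\mathcal F_t$: $$u^*(t)=e^{-\kappa/\lambda}Y_t+\kappa\int_t^{t+1/\lambda}e^{-\kappa(t+1/\lambda-s)}\mu(s)\,ds+\frac{\bar\gamma\nu}{\kappa}\big(1-e^{-\kappa/\lambda}\big).$$ -/

import Mathlib

open MeasureTheory ProbabilityTheory Set
open scoped NNReal ENNReal

namespace PowerDemand

noncomputable section

/-- A homogeneous Poisson process with intensity `ν`: it starts at `0`, has independent increments,
the increment over `(s, t]` is Poisson distributed with parameter `ν (t - s)`, and almost all paths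
are nondecreasing and right-continuous. (The subtraction in `ℕ` is a true one, since almost all
paths are nondecreasing.) -/
structure IsPoissonProcess {Ω : Type*} [MeasurableSpace Ω] (N : ℝ≥0 → Ω → ℕ) (ν : ℝ≥0)
    (P : Measure Ω) : Prop where
  measurable : ∀ t, Measurable (N t)
  zero : ∀ᵐ ω ∂P, N 0 ω = 0
  indep : HasIndepIncrements N P
  law : ∀ s t : ℝ≥0, s ≤ t →
    HasLaw (fun ω => N t ω - N s ω) (poissonMeasure (ν * (t - s))) P
  mono : ∀ᵐ ω ∂P, Monotone (fun t => N t ω)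
  rightCont : ∀ᵐ ω ∂P, ∀ t, ContinuousWithinAt (fun r => N r ω) (Ici t) t

/-- The noise that drives the demand: a Brownian motion `W`, a Poisson process `N` of intensity `ν`
and i.i.d. square-integrable jump heights (`γ i` is the height of jump number `i + 1`) of mean
`γbar`. `W` is independent of `N`, and the jump heights are independent of the pair `(W, N)`. -/
structure IsDrivingNoise {Ω : Type*} [MeasurableSpace Ω] (P : Measure Ω)
    (W : ℝ≥0 → Ω → ℝ) (N : ℝ≥0 → Ω → ℕ) (γ : ℕ → Ω → ℝ) (ν : ℝ≥0) (γbar : ℝ) : Prop where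
  measurable_W : ∀ t, Measurable (W t)
  brownian : IsBrownianReal W P
  poisson : IsPoissonProcess N ν P
  measurable_γ : ∀ i, Measurable (γ i)
  iIndep_γ : iIndepFun γ P
  ident_γ : ∀ i, IdentDistrib (γ i) (γ 0) P P
  memLp_γ : MemLp (γ 0) 2 P
  mean_γ : ∫ ω, γ 0 ω ∂P = γbar
  indep_W_N : IndepFun (fun ω t => W t ω) (fun ω t => N t ω) P
  indep_γ : IndepFun (fun ω i => γ i ω) (fun ω => ((fun t => W t ω), (fun t => N t ω))) P

/-- `Y` solves `dY = κ (μ(t) - Y) dt + σ dW + γ dN`, `Y₀ = y₀` on `[0, T]`. This is the integral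
form of the equation: since `σ` is constant and `W₀ = 0` almost surely, the stochastic integral
`∫₀ᵗ σ dW` is `σ W_t`, and `∫₀ᵗ γ dN` is the sum of the heights of the first `N_t` jumps. -/
structure IsDemand {Ω : Type*} [MeasurableSpace Ω] (P : Measure Ω) (κ σ y₀ T : ℝ) (μ : ℝ → ℝ)
    (W : ℝ≥0 → Ω → ℝ) (N : ℝ≥0 → Ω → ℕ) (γ : ℕ → Ω → ℝ) (Y : ℝ → Ω → ℝ) : Prop where
  measurable : ∀ t ∈ Icc 0 T, Measurable (Y t)
  integrable_path : ∀ᵐ ω ∂P, IntegrableOn (fun t => Y t ω) (Icc 0 T)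
  equation : ∀ᵐ ω ∂P, ∀ t ∈ Icc 0 T,
    Y t ω = y₀ + (∫ s in (0 : ℝ)..t, κ * (μ s - Y s ω)) + σ * W t.toNNReal ω
      + ∑ i ∈ Finset.range (N t.toNNReal ω), γ i ω

/-- The information `ℱ_t = σ(Y_s ; 0 ≤ s ≤ t)`. -/
@[reducible] def demandInfo {Ω : Type*} (Y : ℝ → Ω → ℝ) (t : ℝ) : MeasurableSpace Ω :=
  ⨆ s ∈ Icc (0 : ℝ) t, MeasurableSpace.comap (Y s) inferInstance

/-- The last of the update times `0, Δ, 2Δ, …` that is not after `t`. -/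
def lastUpdate (Δ t : ℝ) : ℝ := (⌊t / Δ⌋₊ : ℝ) * Δ

theorem lastUpdate_eq {Δ t : ℝ} (hΔ : 0 < Δ) (i : ℕ)
    (ht : t ∈ Ico ((i : ℝ) * Δ) (((i : ℝ) + 1) * Δ)) : lastUpdate Δ t = (i : ℝ) * Δ := by
  have h0 : (0 : ℝ) ≤ t / Δ :=
    div_nonneg (le_trans (mul_nonneg (Nat.cast_nonneg i) hΔ.le) ht.1) hΔ.le
  have h : ⌊t / Δ⌋₊ = i := by
    rw [Nat.floor_eq_iff h0]
    exact ⟨(le_div_iff₀ hΔ).2 ht.1, (div_lt_iff₀ hΔ).2 ht.2⟩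
  rw [lastUpdate, h]

/-- `z` is a weak solution of `z_t + lam z_x = 0` on `(0,1) × (0,T)` with `z(x,0) = z₀(x)` and
`z(0,t) = g(t)`, the value `z(1,t)` being the outflow trace: the identity is the one obtained by
multiplying the equation by a `C¹` function `φ` that vanishes at the final time and
integrating by parts. -/
structure IsTransportSolution (lam T : ℝ) (z₀ g : ℝ → ℝ) (z : ℝ → ℝ → ℝ) : Prop where
  integrable : IntegrableOn (fun p : ℝ × ℝ => z p.1 p.2) (Ioo 0 1 ×ˢ Ioo 0 T)
  integrable_outflow : IntegrableOn (fun t => z 1 t) (Ioo 0 T)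
  weak : ∀ φ : ℝ × ℝ → ℝ, ContDiff ℝ 1 φ → (∀ x ∈ Icc (0 : ℝ) 1, φ (x, T) = 0) →
    (∫ p in Ioo (0 : ℝ) 1 ×ˢ Ioo 0 T,
        z p.1 p.2 * (fderiv ℝ φ p (0, 1) + lam * fderiv ℝ φ p (1, 0)))
      + (∫ x in (0 : ℝ)..1, z₀ x * φ (x, 0))
      + lam * (∫ t in (0 : ℝ)..T, g t * φ (0, t))
      = lam * ∫ t in (0 : ℝ)..T, z 1 t * φ (1, t)

/-- `z` is the (random) state belonging to the control `u`: for almost every `ω` the path `z ω`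
solves the transport equation with inflow `u(·, ω)` on `[0, T - 1/lam]` (production is stopped
afterwards), and the outflow `y(s) = z(1, s)` is a measurable process on `[1/lam, T]`. -/
structure IsState {Ω : Type*} [MeasurableSpace Ω] (P : Measure Ω) (lam T : ℝ) (z₀ : ℝ → ℝ)
    (u : ℝ → Ω → ℝ) (z : Ω → ℝ → ℝ → ℝ) : Prop where
  transport : ∀ᵐ ω ∂P,
    IsTransportSolution lam T z₀ ((Icc 0 (T - 1 / lam)).indicator fun t => u t ω) (z ω)
  outflow : AEStronglyMeasurable (fun p : ℝ × Ω => z p.2 1 p.1)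
    ((volume.restrict (Icc (1 / lam) T)).prod P)

/-- The objective `∫_{1/lam}^T E[(Y_s - y(s))²] ds`, where `y(s) = z(1, s)`. -/
def objective {Ω : Type*} [MeasurableSpace Ω] (P : Measure Ω) (lam T : ℝ) (Y : ℝ → Ω → ℝ)
    (z : Ω → ℝ → ℝ → ℝ) : ℝ≥0∞ :=
  ∫⁻ s in Icc (1 / lam) T, ∫⁻ ω, ENNReal.ofReal ((Y s ω - z ω 1 s) ^ 2) ∂P

/-- Admissible controls for the information `G`: square-integrable processes `u` on
`[0, T - 1/lam]` such that `u(t)` is `G t`-measurable for every `t`. -/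
structure IsAdmissible {Ω : Type*} [MeasurableSpace Ω] (P : Measure Ω) (lam T : ℝ)
    (G : ℝ → MeasurableSpace Ω) (u : ℝ → Ω → ℝ) : Prop where
  memLp : MemLp (fun p : ℝ × Ω => u p.1 p.2) 2 ((volume.restrict (Icc 0 (T - 1 / lam))).prod P)
  measurable : ∀ t ∈ Icc 0 (T - 1 / lam), Measurable[G t] (u t)

/-- `u` is admissible, has a state, and minimizes the objective among all admissible controls. -/
def IsOptimalControl {Ω : Type*} [MeasurableSpace Ω] (P : Measure Ω) (lam T : ℝ) (z₀ : ℝ → ℝ)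
    (Y : ℝ → Ω → ℝ) (G : ℝ → MeasurableSpace Ω) (u : ℝ → Ω → ℝ) : Prop :=
  IsAdmissible P lam T G u ∧ (∃ z, IsState P lam T z₀ u z) ∧
    ∀ z, IsState P lam T z₀ u z → ∀ v, IsAdmissible P lam T G v → ∀ z', IsState P lam T z₀ v z' →
      objective P lam T Y z ≤ objective P lam T Y z'

/-- `u` is the optimal control: it is optimal, and every optimal control equals `u` almost
everywhere on `[0, T - 1/lam] × Ω`. -/
def IsTheOptimalControl {Ω : Type*} [MeasurableSpace Ω] (P : Measure Ω) (lam T : ℝ) (z₀ : ℝ → ℝ)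
    (Y : ℝ → Ω → ℝ) (G : ℝ → MeasurableSpace Ω) (u : ℝ → Ω → ℝ) : Prop :=
  IsOptimalControl P lam T z₀ Y G u ∧
    ∀ v, IsOptimalControl P lam T z₀ Y G v →
      ∀ᵐ p ∂((volume.restrict (Icc 0 (T - 1 / lam))).prod P), v p.1 p.2 = u p.1 p.2

/-- The control without demand updates. -/
def controlNoUpdates {Ω : Type*} (κ lam ν γbar y₀ : ℝ) (μ : ℝ → ℝ) : ℝ → Ω → ℝ := fun t _ =>
  Real.exp (-κ * (t + 1 / lam)) * y₀
    + κ * (∫ s in (0 : ℝ)..(t + 1 / lam), Real.exp (-κ * (t + 1 / lam - s)) * μ s)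
    + γbar * ν / κ * (1 - Real.exp (-κ * (t + 1 / lam)))

/-- The control with updates at the times `0, Δ, 2Δ, …`. -/
def controlUpdates {Ω : Type*} (κ lam ν γbar Δ : ℝ) (μ : ℝ → ℝ) (Y : ℝ → Ω → ℝ) :
    ℝ → Ω → ℝ := fun t ω =>
  Real.exp (-κ * (t + 1 / lam - lastUpdate Δ t)) * Y (lastUpdate Δ t) ω
    + κ * (∫ s in (lastUpdate Δ t)..(t + 1 / lam), Real.exp (-κ * (t + 1 / lam - s)) * μ s)
    + γbar * ν / κ * (1 - Real.exp (-κ * (t + 1 / lam - lastUpdate Δ t)))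

/-- The control in the idealized setting. -/
def controlIdealized {Ω : Type*} (κ lam ν γbar : ℝ) (μ : ℝ → ℝ) (Y : ℝ → Ω → ℝ) :
    ℝ → Ω → ℝ := fun t ω =>
  Real.exp (-κ / lam) * Y t ω
    + κ * (∫ s in t..(t + 1 / lam), Real.exp (-κ * (t + 1 / lam - s)) * μ s)
    + γbar * ν / κ * (1 - Real.exp (-κ / lam))

end

end PowerDemand

open PowerDemand

/-!
The demand solves a linear equation with additive noise, so its path is an explicit functional of
the path of the noise (`variation_of_constants`, `IsDemand.ae_eq_noise`). In particular the demand
is bounded in `L²`, and the information that the demand carries up to time `s` is contained, up to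
null sets, in what the noise reveals up to time `s`.

*Conditional expectation.* For an event `A` of the past up to time `s`, the increment of the noise
over `(s, r]` has mean `γbar ν (r - s)` on `A` (`IsDrivingNoise.setIntegral_noise_increment`). The
demand does not reveal `W`, `N` and the jump heights separately, so the jump part needs two
enlargements of the past: `pastInfo` contains `W` and `N` up to time `s` and *all* jump heights, and
is still independent of the later increments of `W` and `N`; `jumpInfo` contains *all* of `W`, `N`
and the first `i` jump heights, and is still independent of the height `γ i`. An event `A` of the
past agrees almost surely with an event of `pastInfo`, and on `{N s ≤ i}` with an event of
`jumpInfo`. Summing `∫_A 1_{N s ≤ i < N r} γ i` over `i` therefore gives `γbar` times the integral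
over `A` of the number of jumps. Consequently the function `t ↦ ∫_A Y t` solves a deterministic
linear equation on `[s, T]`, with drift `γbar ν` in place of the jumps. Its solution is the claimed
formula for the conditional expectation (`IsDemand.condExp_eq`).

*Transport.* Test functions that are constant along the characteristics show that the outflow of
every weak solution is the inflow delayed by `1 / lam` (`IsTransportSolution.outflow_eq`), and the
method of characteristics gives a solution for every control (`isTransportSolution_charData`). Hence
the objective of `u` is `∫ E[(Y (t + 1 / lam) - u t)²] dt` (`objective_eq`).

*Optimality.* By Pythagoras this objective exceeds its value at the conditional expectation exactly
by the squared `L²` distance of the two controls (`lintegral_sub_sq_eq_add`), which gives both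
optimality and uniqueness. The three information levels are all of the form
`demandInfo Y (θ t)` for a measurable `θ` with `0 ≤ θ t ≤ t`, and are treated together in
`IsDemand.isTheOptimalControl_forecast`.
-/

namespace PowerDemand

/-! ### Independence of σ-algebras -/

/-- If `x`, `a` are independent, and `b` is independent of `x` and `a` jointly, then `x` is
independent of `a` and `b` jointly. -/
theorem indep_sup_right {Ω : Type*} {x a b mΩ : MeasurableSpace Ω} {P : Measure Ω}
    [IsProbabilityMeasure P] (hx : x ≤ mΩ) (ha : a ≤ mΩ) (hb : b ≤ mΩ)
    (h : Indep x a P) (h' : Indep (x ⊔ a) b P) : Indep x (a ⊔ b) P := by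
  have hgen : a ⊔ b = MeasurableSpace.generateFrom
      {s | ∃ A B, MeasurableSet[a] A ∧ MeasurableSet[b] B ∧ s = A ∩ B} := by
    apply le_antisymm
    · refine sup_le (fun A hA => ?_) (fun B hB => ?_)
      · exact MeasurableSpace.measurableSet_generateFrom
          ⟨A, univ, hA, MeasurableSet.univ, by simp⟩
      · exact MeasurableSpace.measurableSet_generateFrom
          ⟨univ, B, MeasurableSet.univ, hB, by simp⟩
    · refine MeasurableSpace.generateFrom_le ?_
      rintro s ⟨A, B, hA, hB, rfl⟩
      exact MeasurableSet.inter (le_sup_left (b := b) A hA) (le_sup_right (a := a) B hB)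
  refine IndepSets.indep hx (sup_le ha hb) (@MeasurableSpace.isPiSystem_measurableSet Ω x) ?_
    (@MeasurableSpace.generateFrom_measurableSet Ω x).symm hgen ?_
  · rintro s ⟨A, B, hA, hB, rfl⟩ t ⟨A', B', hA', hB', rfl⟩ -
    exact ⟨A ∩ A', B ∩ B', hA.inter hA', hB.inter hB', by ext; simp; tauto⟩
  · rw [IndepSets_iff]
    rintro X s hX ⟨A, B, hA, hB, rfl⟩
    rw [Indep_iff] at h h'
    have hXm : MeasurableSet[x ⊔ a] X := le_sup_left (b := a) X hX
    have hAm : MeasurableSet[x ⊔ a] A := le_sup_right (a := x) A hA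
    rw [← inter_assoc, h' _ _ (hXm.inter hAm) hB, h' _ _ hAm hB, h _ _ hX hA, mul_assoc]

theorem setIntegral_eq_of_indep {Ω : Type*} {m₁ m₂ mΩ : MeasurableSpace Ω} {P : Measure Ω}
    [IsProbabilityMeasure P] (h₁ : m₁ ≤ mΩ) (h₂ : m₂ ≤ mΩ) (h : Indep m₁ m₂ P) {f : Ω → ℝ}
    (hf : Measurable[m₁] f) (hfi : Integrable f P) {A : Set Ω} (hA : MeasurableSet[m₂] A) :
    ∫ ω in A, f ω ∂P = P.real A * ∫ ω, f ω ∂P := by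
  rw [← setIntegral_condExp h₂ hfi hA,
    integral_congr_ae (ae_restrict_of_ae (condExp_indep_eq h₁ h₂ hf.stronglyMeasurable h))]
  simp

/-! ### Almost sure versions of σ-algebras and processes -/

/-- If on the event `B` each generator `Y i` of a σ-algebra agrees almost surely with an
`m`-measurable variable, then on `B` the σ-algebra consists, up to null sets, of `m`-measurable
sets. -/
theorem exists_measurableSet_of_iSup_comap {Ω ι : Type*} {m mΩ : MeasurableSpace Ω} {P : Measure Ω}
    {Y : ι → Ω → ℝ} {S : Set ι} {B : Set Ω}
    (h : ∀ i ∈ S, ∃ Z : Ω → ℝ, Measurable[m] Z ∧ ∀ᵐ ω ∂P, ω ∈ B → Y i ω = Z ω)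
    {A : Set Ω}
    (hA : MeasurableSet[⨆ i ∈ S, MeasurableSpace.comap (Y i) inferInstance] A) :
    ∃ A', MeasurableSet[m] A' ∧ ∀ᵐ ω ∂P, ω ∈ B → (ω ∈ A ↔ ω ∈ A') := by
  let 𝒮 : MeasurableSpace Ω :=
    { MeasurableSet' := fun A => ∃ A', MeasurableSet[m] A' ∧ ∀ᵐ ω ∂P, ω ∈ B → (ω ∈ A ↔ ω ∈ A')
      measurableSet_empty := ⟨∅, @MeasurableSet.empty _ m, by simp⟩
      measurableSet_compl := by
        rintro A ⟨A', hA', h⟩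
        refine ⟨A'ᶜ, hA'.compl, ?_⟩
        filter_upwards [h] with ω hω hB
        simp [hω hB]
      measurableSet_iUnion := by
        intro f hf
        choose g hg hfg using hf
        refine ⟨⋃ i, g i, MeasurableSet.iUnion hg, ?_⟩
        filter_upwards [ae_all_iff.2 hfg] with ω hω hB
        simp [fun i => hω i hB] }
  have hle : (⨆ i ∈ S, MeasurableSpace.comap (Y i) inferInstance) ≤ 𝒮 := by
    refine iSup₂_le fun i hi => ?_
    rintro _ ⟨s, hs, rfl⟩
    obtain ⟨Z, hZ, hYZ⟩ := h i hi
    refine ⟨Z ⁻¹' s, hZ hs, ?_⟩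
    filter_upwards [hYZ] with ω hω hB
    simp [hω hB]
  exact hle A hA

/-- A process has a jointly measurable version that agrees with it along every right-continuous
path: the limit of its values at the times `(⌊n r⌋ + 1) / n`, which decrease to `r`. -/
theorem exists_stronglyMeasurable_version {Ω : Type*} {m : MeasurableSpace Ω} {X : ℝ → Ω → ℝ}
    (hX : ∀ r, Measurable (X r)) :
    ∃ X' : ℝ × Ω → ℝ, StronglyMeasurable X' ∧
      ∀ ω, (∀ r, ContinuousWithinAt (fun r => X r ω) (Ici r) r) → ∀ r, X' (r, ω) = X r ω := by
  let d : ℕ → ℝ → ℝ := fun n r => ((⌊(n + 1 : ℝ) * r⌋ : ℝ) + 1) / (n + 1)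
  let F : ℕ → ℝ × Ω → ℝ := fun n p => X (d n p.1) p.2
  have hF : ∀ n, StronglyMeasurable (F n) := by
    intro n
    have h1 : Measurable fun q : ℤ × Ω => X (((q.1 : ℝ) + 1) / (n + 1)) q.2 :=
      measurable_from_prod_countable_right fun k => hX (((k : ℝ) + 1) / (n + 1))
    have h2 : Measurable fun p : ℝ × Ω => (⌊(n + 1 : ℝ) * p.1⌋, p.2) :=
      (Int.measurable_floor.comp (measurable_fst.const_mul _)).prodMk measurable_snd
    exact (h1.comp h2).stronglyMeasurable
  refine ⟨fun p => Filter.limUnder Filter.atTop fun n => F n p, StronglyMeasurable.limUnder hF, ?_⟩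
  intro ω hω r
  refine Filter.Tendsto.limUnder_eq ?_
  have hd : Filter.Tendsto (fun n => d n r) Filter.atTop (nhdsWithin r (Ici r)) := by
    have hpos : ∀ n : ℕ, (0 : ℝ) < n + 1 := fun n => by positivity
    refine tendsto_nhdsWithin_iff.2 ⟨?_, Filter.Eventually.of_forall fun n => ?_⟩
    · have hlim : Filter.Tendsto (fun n : ℕ => r + 1 / ((n : ℝ) + 1)) Filter.atTop (nhds r) := by
        simpa using tendsto_const_nhds.add tendsto_one_div_add_atTop_nhds_zero_nat (a := r)
      refine tendsto_of_tendsto_of_tendsto_of_le_of_le tendsto_const_nhds hlim ?_ ?_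
      · intro n
        simp only [d]
        rw [le_div_iff₀ (hpos n)]
        linarith [Int.lt_floor_add_one ((n + 1 : ℝ) * r)]
      · intro n
        simp only [d]
        have hr : r + 1 / ((n : ℝ) + 1) = ((n + 1 : ℝ) * r + 1) / (n + 1) := by
          have := (hpos n).ne'
          field_simp
        rw [hr]
        gcongr
        linarith [Int.floor_le ((n + 1 : ℝ) * r)]
    · simp only [d, mem_Ici]
      rw [le_div_iff₀ (hpos n)]
      linarith [Int.lt_floor_add_one ((n + 1 : ℝ) * r)]
  exact (hω r).tendsto.comp hd

/-- A random variable taken at a random integer index. -/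
theorem measurable_random_index {Ω : Type*} {m : MeasurableSpace Ω} {f : ℕ → Ω → ℝ} {n : Ω → ℕ}
    (hf : ∀ k, Measurable (f k)) (hn : Measurable n) : Measurable fun ω => f (n ω) ω :=
  (measurable_from_prod_countable_right (f := fun q : ℕ × Ω => f q.1 q.2) hf).comp
    (hn.prodMk measurable_id)

/-! ### Moments of the Poisson distribution -/

theorem integrable_sq_poissonMeasure (r : ℝ≥0) :
    Integrable (fun n : ℕ => (n : ℝ) ^ 2) (poissonMeasure r) := by
  rw [integrable_poissonMeasure_iff]
  have hs : Summable fun n : ℕ => Real.exp (-r) * ((4 * (r : ℝ)) ^ n / (n.factorial : ℝ)) :=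
    (Real.summable_pow_div_factorial _).mul_left _
  refine Summable.of_nonneg_of_le (fun n => by positivity) (fun n => ?_) hs
  have h4 : (n : ℝ) ^ 2 ≤ 4 ^ n := by
    have h2 : (n : ℝ) ≤ 2 ^ n := by exact_mod_cast Nat.lt_two_pow_self.le
    calc (n : ℝ) ^ 2 ≤ (2 ^ n) ^ 2 := by gcongr
      _ = 4 ^ n := by rw [← pow_mul, mul_comm, pow_mul]; norm_num
  rw [Real.norm_of_nonneg (by positivity), mul_pow]
  calc Real.exp (-r) * (r : ℝ) ^ n / n.factorial * (n : ℝ) ^ 2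
      ≤ Real.exp (-r) * (r : ℝ) ^ n / n.factorial * 4 ^ n := by gcongr
    _ = _ := by ring

theorem integral_poissonMeasure_natCast (r : ℝ≥0) :
    ∫ n : ℕ, (n : ℝ) ∂(poissonMeasure r) = r := by
  have hs := hasSum_one_poissonMeasure r
  have hs' : HasSum (fun n : ℕ => (Real.exp (-r) * (r : ℝ) ^ (n + 1) / ((n + 1).factorial : ℝ))
      * ((n + 1 : ℕ) : ℝ)) (r : ℝ) := by
    have := hs.mul_left (r : ℝ)
    rw [mul_one] at this
    have hterm : ∀ n : ℕ, Real.exp (-r) * (r : ℝ) ^ (n + 1) / ((n + 1).factorial : ℝ)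
        * ((n + 1 : ℕ) : ℝ) = r * (Real.exp (-r) * (r : ℝ) ^ n / (n.factorial : ℝ)) := by
      intro n
      rw [Nat.factorial_succ]
      push_cast
      field_simp
      ring
    simp_rw [hterm]
    exact this
  rw [integral_poissonMeasure]
  have := (hasSum_nat_add_iff' (f := fun n : ℕ =>
    (Real.exp (-r) * (r : ℝ) ^ n / (n.factorial : ℝ)) • (n : ℝ)) (g := (r : ℝ)) 1).1
    (by simpa using hs')
  exact this.tsum_eq

/-! ### Increments of a Poisson process -/

/-- An increment is independent of the whole past, not only of finitely many earlier increments: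
finitely many past values are partial sums of increments over a common partition. -/
theorem IsPoissonProcess.indepFun_increment {Ω : Type*} [MeasurableSpace Ω] {N : ℝ≥0 → Ω → ℕ}
    {ν : ℝ≥0} {P : Measure Ω} [IsProbabilityMeasure P] (h : IsPoissonProcess N ν P)
    {s r : ℝ≥0} (hsr : s ≤ r) :
    IndepFun (fun ω => N r ω - N s ω) (fun ω (v : Iic s) => N v ω) P := by
  refine IndepFun.indepFun_process ((h.measurable r).sub (h.measurable s))
    (fun v => h.measurable v) fun I => ?_
  -- the partition of `[0, r]` by the times in `I` and the points `0`, `s`, `r`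
  let J : Finset ℝ≥0 := insert 0 (insert s (I.image fun v : Iic s => (v : ℝ≥0)))
  have hJs : ∀ v ∈ J, v ≤ s := by
    intro v hv
    simp only [J, Finset.mem_insert, Finset.mem_image] at hv
    rcases hv with rfl | rfl | ⟨w, -, rfl⟩
    · exact zero_le
    · exact le_rfl
    · exact w.2
  obtain ⟨n, hn⟩ : ∃ n, J.card = n + 1 :=
    ⟨J.card - 1, (Nat.sub_add_cancel (Finset.card_pos.2 ⟨0, by simp [J]⟩)).symm⟩
  let e := J.orderEmbOfFin hn
  have heJ : ∀ v ∈ J, ∃ k, e k = v := by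
    intro v hv
    have : v ∈ Set.range e := by rw [Finset.range_orderEmbOfFin]; exact hv
    exact this
  let t : ℕ → ℝ≥0 := fun k => if hk : k < n + 1 then e ⟨k, hk⟩ else r
  have ht : Monotone t := by
    intro a b hab
    simp only [t]
    split_ifs with h1 h2 h2
    · exact e.monotone (by simpa using hab)
    · exact (hJs _ (J.orderEmbOfFin_mem hn _)).trans hsr
    · omega
    · exact le_rfl
  have ht0 : t 0 = 0 := by
    obtain ⟨k, hk⟩ := heJ 0 (by simp [J])
    have : e ⟨0, by omega⟩ ≤ e k := e.monotone (by simp)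
    simpa [t, hk] using this
  have htn : t n = s := by
    obtain ⟨k, hk⟩ := heJ s (by simp [J])
    have h1 : e k ≤ e ⟨n, by omega⟩ := e.monotone (by simp only [Fin.le_def]; omega)
    have h2 := hJs _ (J.orderEmbOfFin_mem hn ⟨n, by omega⟩)
    simp only [t, Nat.lt_succ_self, dif_pos]
    exact le_antisymm h2 (hk ▸ h1)
  have htr : t (n + 1) = r := by simp [t]
  have hind := (h.indep.nat ht).indepFun_finset {n} (Finset.range n) (by simp)
    (fun k => (h.measurable _).sub (h.measurable _))
  choose! k hk using heJ
  have hind' := hind.comp (φ := fun f => f ⟨n, by simp⟩)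
    (ψ := fun f (v : I) => ∑ j : Finset.range n,
      if (j : ℕ) < (k (v : Iic s) : ℕ) then f j else 0)
    (measurable_pi_apply (X := fun _ : ({n} : Finset ℕ) => ℕ) ⟨n, by simp⟩) (by
      refine measurable_pi_lambda _ fun v => Finset.measurable_sum _ fun j _ => ?_
      split_ifs
      · exact measurable_pi_apply _
      · exact measurable_const)
  refine hind'.congr ?_ ?_
  · refine Filter.EventuallyEq.of_eq ?_
    funext ω
    simp [htn, htr]
  · filter_upwards [h.zero, h.mono] with ω h0 hm
    funext v
    have hvJ : (v : Iic s).1 ∈ J := by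
      simp only [J, Finset.mem_insert, Finset.mem_image]
      exact Or.inr (Or.inr ⟨v, v.2, rfl⟩)
    have hkn : (k (v : Iic s) : ℕ) ≤ n := by have := (k (v : Iic s)).2; omega
    have htk : t (k (v : Iic s)) = (v : Iic s) := by
      simp only [t, (k (v : Iic s)).2, dif_pos]
      exact hk _ hvJ
    have hsum : ∀ i : ℕ, ∑ j ∈ Finset.range i, (N (t (j + 1)) ω - N (t j) ω) = N (t i) ω := by
      intro i
      induction i with
      | zero => simp [ht0, h0]
      | succ i ih =>
        rw [Finset.sum_range_succ, ih]
        have : N (t i) ω ≤ N (t (i + 1)) ω := hm (ht (Nat.le_succ i))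
        omega
    simp only [Function.comp]
    have hval : N (v : Iic s) ω = N (t (k (v : Iic s))) ω := by rw [htk]
    rw [hval, ← hsum, ← Finset.attach_eq_univ, Finset.sum_attach (Finset.range n)
      (f := fun j => if j < (k (v : Iic s) : ℕ) then N (t (j + 1)) ω - N (t j) ω else 0),
      ← Finset.sum_filter]
    refine Finset.sum_congr ?_ fun _ _ => rfl
    ext j
    simp
    omega

/-! ### Linear integral equations -/

/-- Variation of constants: the solution of `y' = κ (f - y) + ℓ'`, in integral form. The
function `ℓ` need not be differentiable; its integrability follows from the equation. -/
theorem variation_of_constants {κ a b c : ℝ} (hab : a ≤ b) {y f ℓ : ℝ → ℝ}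
    (hf : IntervalIntegrable f volume a b) (hy : IntervalIntegrable y volume a b)
    (h : ∀ t ∈ Icc a b, y t = c + (∫ s in a..t, κ * (f s - y s)) + ℓ t) :
    y b = Real.exp (-κ * (b - a)) * c + κ * (∫ r in a..b, Real.exp (-κ * (b - r)) * f r)
      + ℓ b - κ * ∫ r in a..b, Real.exp (-κ * (b - r)) * ℓ r := by
  set g : ℝ → ℝ := fun s => κ * (f s - y s) with hg
  have hgi : IntervalIntegrable g volume a b := (hf.sub hy).const_mul κ
  set X : ℝ → ℝ := fun t => ∫ s in a..t, g s with hX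
  have hXac : AbsolutelyContinuousOnInterval X a b :=
    hgi.absolutelyContinuousOnInterval_intervalIntegral (by simp)
  have hEd : ∀ r, HasDerivAt (fun r => Real.exp (-κ * (b - r))) (κ * Real.exp (-κ * (b - r)))
      r := by
    intro r
    have h1 : HasDerivAt (fun r => -κ * (b - r)) κ r := by
      simpa using ((hasDerivAt_id r).const_sub b).const_mul (-κ)
    simpa [mul_comm] using h1.exp
  have hEac : AbsolutelyContinuousOnInterval (fun r => Real.exp (-κ * (b - r))) a b := by
    apply ContDiffOn.absolutelyContinuousOnInterval
    fun_prop
  have hEc : Continuous fun r => Real.exp (-κ * (b - r)) := by fun_prop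
  have hXc : ContinuousOn X (uIcc a b) := hXac.continuousOn
  have hℓ : ∀ t ∈ uIcc a b, ℓ t = y t - c - X t := by
    intro t ht
    rw [uIcc_of_le hab] at ht
    have := h t ht
    simp only [hX]
    linarith
  have hparts := hEac.integral_mul_deriv_eq_deriv_mul hXac
  have h1 : ∫ r in a..b, Real.exp (-κ * (b - r)) * deriv X r
      = ∫ r in a..b, Real.exp (-κ * (b - r)) * g r := by
    apply intervalIntegral.integral_congr_ae
    filter_upwards [hgi.ae_hasDerivAt_integral] with r hr hrab
    rw [(hr (uIoc_subset_uIcc hrab) a (by simp)).deriv]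
  have h2 : ∫ r in a..b, deriv (fun r => Real.exp (-κ * (b - r))) r * X r
      = ∫ r in a..b, (κ * (Real.exp (-κ * (b - r)) * y r)
        - c * (κ * Real.exp (-κ * (b - r))) - κ * (Real.exp (-κ * (b - r)) * ℓ r)) := by
    apply intervalIntegral.integral_congr
    intro r hr
    simp only [(hEd r).deriv, hℓ r hr]
    ring
  have hEy : IntervalIntegrable (fun r => Real.exp (-κ * (b - r)) * y r) volume a b :=
    hy.continuousOn_mul hEc.continuousOn
  have hEf : IntervalIntegrable (fun r => Real.exp (-κ * (b - r)) * f r) volume a b :=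
    hf.continuousOn_mul hEc.continuousOn
  have hEX : IntervalIntegrable (fun r => Real.exp (-κ * (b - r)) * X r) volume a b :=
    (hEc.continuousOn.mul hXc).intervalIntegrable
  have hEi : IntervalIntegrable (fun r => Real.exp (-κ * (b - r))) volume a b :=
    hEc.intervalIntegrable _ _
  have hEℓ : IntervalIntegrable (fun r => Real.exp (-κ * (b - r)) * ℓ r) volume a b := by
    refine ((hEy.sub (hEi.const_mul c)).sub hEX).congr ?_
    intro r hr
    simp only [hℓ r (uIoc_subset_uIcc hr)]
    ring
  have hEint : ∫ r in a..b, κ * Real.exp (-κ * (b - r)) = 1 - Real.exp (-κ * (b - a)) := by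
    rw [intervalIntegral.integral_eq_sub_of_hasDerivAt (fun r _ => hEd r) (hEi.const_mul κ)]
    simp
  rw [h1, h2, intervalIntegral.integral_sub ((hEy.const_mul κ).sub ((hEi.const_mul κ).const_mul c))
    (hEℓ.const_mul κ), intervalIntegral.integral_sub (hEy.const_mul κ)
    ((hEi.const_mul κ).const_mul c)] at hparts
  have h3 : ∫ r in a..b, Real.exp (-κ * (b - r)) * g r
      = κ * (∫ r in a..b, Real.exp (-κ * (b - r)) * f r)
        - κ * ∫ r in a..b, Real.exp (-κ * (b - r)) * y r := by
    rw [← mul_sub, ← intervalIntegral.integral_sub hEf hEy, ← intervalIntegral.integral_const_mul]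
    congr 1
    funext r
    simp only [hg]
    ring
  rw [h3] at hparts
  simp only [intervalIntegral.integral_const_mul] at hparts hEint
  rw [hEint] at hparts
  have hXa : X a = 0 := by simp [hX]
  have hyb := h b ⟨hab, le_rfl⟩
  have hXb : X b = ∫ s in a..b, g s := rfl
  rw [← hXb] at hyb
  simp only [sub_self, mul_zero, Real.exp_zero, hXa, one_mul, sub_zero] at hparts
  rw [hyb]
  linear_combination -hparts

/-! ### Time integrals of square-integrable processes -/

/-- Minkowski's inequality, in qualitative form, for the time integral of a square-integrable
process. -/
theorem memLp_two_integral_left {α Ω : Type*} {mα : MeasurableSpace α} {mΩ : MeasurableSpace Ω}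
    {ρ : Measure α} [IsFiniteMeasure ρ] {P : Measure Ω} [IsFiniteMeasure P] {F : α × Ω → ℝ}
    (hF : MemLp F 2 (ρ.prod P)) : MemLp (fun ω => ∫ r, F (r, ω) ∂ρ) 2 P := by
  have hmeas : AEStronglyMeasurable (fun ω => ∫ r, F (r, ω) ∂ρ) P :=
    hF.1.prod_swap.integral_prod_right'
  have hsq : Integrable (fun p => F p ^ 2) (ρ.prod P) := hF.integrable_sq
  rw [memLp_two_iff_integrable_sq hmeas]
  have hint : Integrable (fun ω => ρ.real univ * ∫ r, F (r, ω) ^ 2 ∂ρ) P :=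
    (hsq.integral_prod_right).const_mul _
  refine hint.mono' (hmeas.pow 2) ?_
  have hae : ∀ᵐ ω ∂P, Integrable (fun r => F (r, ω) ^ 2) ρ := hsq.prod_left_ae
  have hae' : ∀ᵐ ω ∂P, AEStronglyMeasurable (fun r => F (r, ω)) ρ :=
    hF.1.prod_swap.prodMk_left
  filter_upwards [hae, hae'] with ω h1 h2
  have hL : MemLp (fun r => F (r, ω)) 2 ρ := (memLp_two_iff_integrable_sq h2).2 h1
  rw [Real.norm_of_nonneg (by positivity)]
  have hFi : Integrable (fun r => F (r, ω)) ρ := hL.integrable one_le_two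
  -- the discriminant form of the Cauchy-Schwarz inequality
  have hq : ∀ x : ℝ, 0 ≤ ρ.real univ * (x * x) + (-2 * ∫ r, F (r, ω) ∂ρ) * x
      + ∫ r, F (r, ω) ^ 2 ∂ρ := by
    intro x
    have : 0 ≤ ∫ r, (F (r, ω) - x) ^ 2 ∂ρ := integral_nonneg fun r => sq_nonneg _
    have he : ∫ r, (F (r, ω) - x) ^ 2 ∂ρ = ∫ r, ((F (r, ω) ^ 2 - 2 * x * F (r, ω)) + x ^ 2) ∂ρ := by
      congr 1
      funext r
      ring
    have hd : Integrable (fun r => F (r, ω) ^ 2 - 2 * x * F (r, ω)) ρ :=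
      h1.sub (hFi.const_mul (2 * x))
    rw [he, integral_add hd (integrable_const _), integral_sub h1 (hFi.const_mul _),
      integral_const_mul, integral_const, smul_eq_mul] at this
    linarith
  have := discrim_le_zero hq
  rw [discrim] at this
  linarith

/-! ### The driving noise -/

/-- The noise `σ W_r + ∑_{i < k(N_r)} γ_i` at the real time `r`, where the number of jumps that are
taken into account is the image of `N_r` under `k`. With `k = id` this is the noise that drives the
demand; with `k = min i` only the first `i` jumps are seen. Negative times are sent to `0`. -/
noncomputable def noise {Ω : Type*} (σ : ℝ) (W : ℝ≥0 → Ω → ℝ) (N : ℝ≥0 → Ω → ℕ) (γ : ℕ → Ω → ℝ)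
    (k : ℕ → ℕ) (r : ℝ) (ω : Ω) : ℝ :=
  σ * W r.toNNReal ω + ∑ i ∈ Finset.range (k (N r.toNNReal ω)), γ i ω

/-- The information on `W` and `N` up to time `s` and on all jump heights. -/
@[reducible] def pastInfo {Ω : Type*} (W : ℝ≥0 → Ω → ℝ) (N : ℝ≥0 → Ω → ℕ) (γ : ℕ → Ω → ℝ)
    (s : ℝ≥0) : MeasurableSpace Ω :=
  (MeasurableSpace.comap (fun ω (v : Iic s) => W v ω) inferInstance
    ⊔ MeasurableSpace.comap (fun ω (v : Iic s) => N v ω) inferInstance)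
    ⊔ MeasurableSpace.comap (fun ω i => γ i ω) inferInstance

/-- The information on all of `W` and `N` and on the heights of the first `i` jumps. -/
@[reducible] def jumpInfo {Ω : Type*} (W : ℝ≥0 → Ω → ℝ) (N : ℝ≥0 → Ω → ℕ) (γ : ℕ → Ω → ℝ)
    (i : ℕ) : MeasurableSpace Ω :=
  MeasurableSpace.comap (fun ω (j : Finset.range i) => γ j ω) inferInstance
    ⊔ MeasurableSpace.comap (fun ω => ((fun t => W t ω), (fun t => N t ω))) inferInstance

theorem comap_pi_restrict_le {Ω ι E : Type*} [MeasurableSpace E] (X : ι → Ω → E) (S : Set ι) :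
    MeasurableSpace.comap (fun ω (v : S) => X v ω) inferInstance
      ≤ MeasurableSpace.comap (fun ω v => X v ω) inferInstance := by
  rintro _ ⟨s, hs, rfl⟩
  exact ⟨(fun f (v : S) => f v) ⁻¹' s,
    measurable_pi_lambda (fun (f : ι → E) (v : S) => f v) (fun v => measurable_pi_apply _) hs, rfl⟩

theorem measurable_noise {Ω : Type*} {m : MeasurableSpace Ω} {σ : ℝ} {W : ℝ≥0 → Ω → ℝ}
    {N : ℝ≥0 → Ω → ℕ} {γ : ℕ → Ω → ℝ} {k : ℕ → ℕ} {r : ℝ}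
    (hW : Measurable (W r.toNNReal)) (hN : Measurable (N r.toNNReal))
    (hγ : ∀ n, ∀ i < k n, Measurable (γ i)) : Measurable (noise σ W N γ k r) :=
  (hW.const_mul σ).add (measurable_random_index (f := fun n ω => ∑ i ∈ Finset.range (k n), γ i ω)
    (fun n => Finset.measurable_sum _ fun i hi => hγ n i (Finset.mem_range.1 hi)) hN)

section

variable {Ω : Type*} {W : ℝ≥0 → Ω → ℝ} {N : ℝ≥0 → Ω → ℕ} {γ : ℕ → Ω → ℝ}

theorem comap_W_le (W : ℝ≥0 → Ω → ℝ) (N : ℝ≥0 → Ω → ℕ) :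
    MeasurableSpace.comap (fun ω t => W t ω) inferInstance ≤
      MeasurableSpace.comap (fun ω => ((fun t => W t ω), (fun t => N t ω))) inferInstance :=
  Measurable.comap_le (measurable_fst.comp
    (comap_measurable (fun ω => ((fun t => W t ω), (fun t => N t ω)))))

theorem comap_N_le (W : ℝ≥0 → Ω → ℝ) (N : ℝ≥0 → Ω → ℕ) :
    MeasurableSpace.comap (fun ω t => N t ω) inferInstance ≤
      MeasurableSpace.comap (fun ω => ((fun t => W t ω), (fun t => N t ω))) inferInstance :=
  Measurable.comap_le (measurable_snd.comp
    (comap_measurable (fun ω => ((fun t => W t ω), (fun t => N t ω)))))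

theorem measurable_W_comap (W : ℝ≥0 → Ω → ℝ) (t : ℝ≥0) :
    Measurable[MeasurableSpace.comap (fun ω t => W t ω) inferInstance] (W t) :=
  (measurable_pi_apply (X := fun _ => ℝ) t).comp (comap_measurable (fun ω t => W t ω))

theorem measurable_N_comap (N : ℝ≥0 → Ω → ℕ) (t : ℝ≥0) :
    Measurable[MeasurableSpace.comap (fun ω t => N t ω) inferInstance] (N t) :=
  (measurable_pi_apply (X := fun _ => ℕ) t).comp (comap_measurable (fun ω t => N t ω))

theorem measurable_W_pastInfo {s v : ℝ≥0} (hv : v ≤ s) : Measurable[pastInfo W N γ s] (W v) :=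
  ((measurable_pi_apply (X := fun _ : Iic s => ℝ) ⟨v, hv⟩).comp
    (comap_measurable (fun ω (v : Iic s) => W v ω))).mono
    (le_sup_left.trans le_sup_left) le_rfl

theorem measurable_N_pastInfo {s v : ℝ≥0} (hv : v ≤ s) : Measurable[pastInfo W N γ s] (N v) :=
  ((measurable_pi_apply (X := fun _ : Iic s => ℕ) ⟨v, hv⟩).comp
    (comap_measurable (fun ω (v : Iic s) => N v ω))).mono
    (le_sup_right.trans le_sup_left) le_rfl

theorem measurable_γ_pastInfo (s : ℝ≥0) (i : ℕ) : Measurable[pastInfo W N γ s] (γ i) :=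
  ((measurable_pi_apply (X := fun _ : ℕ => ℝ) i).comp
    (comap_measurable (fun ω i => γ i ω))).mono le_sup_right le_rfl

theorem measurable_W_jumpInfo (i : ℕ) (v : ℝ≥0) : Measurable[jumpInfo W N γ i] (W v) :=
  (measurable_W_comap W v).mono ((comap_W_le W N).trans le_sup_right) le_rfl

theorem measurable_N_jumpInfo (i : ℕ) (v : ℝ≥0) : Measurable[jumpInfo W N γ i] (N v) :=
  (measurable_N_comap N v).mono ((comap_N_le W N).trans le_sup_right) le_rfl

theorem measurable_γ_jumpInfo {i j : ℕ} (hj : j < i) : Measurable[jumpInfo W N γ i] (γ j) :=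
  ((measurable_pi_apply (X := fun _ : Finset.range i => ℝ) ⟨j, Finset.mem_range.2 hj⟩).comp
    (comap_measurable (fun ω (j : Finset.range i) => γ j ω))).mono le_sup_left le_rfl

end

section

variable {Ω : Type*} [MeasurableSpace Ω] {P : Measure Ω} {W : ℝ≥0 → Ω → ℝ} {N : ℝ≥0 → Ω → ℕ}
  {γ : ℕ → Ω → ℝ} {ν : ℝ≥0} {γbar : ℝ}

namespace IsDrivingNoise

theorem noise_rightCont (h : IsDrivingNoise P W N γ ν γbar) (σ : ℝ) :
    ∀ᵐ ω ∂P, ∀ (k : ℕ → ℕ) (r : ℝ),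
      ContinuousWithinAt (fun r => noise σ W N γ k r ω) (Ici r) r := by
  filter_upwards [h.brownian.cont, h.poisson.rightCont] with ω hW hN k r
  have h1 : ContinuousWithinAt (fun r : ℝ => N r.toNNReal ω) (Ici r) r :=
    (hN r.toNNReal).comp continuous_real_toNNReal.continuousWithinAt
      (fun x hx => Real.toNNReal_mono hx)
  have h2 : ContinuousWithinAt (fun r : ℝ => ∑ i ∈ Finset.range (k (N r.toNNReal ω)), γ i ω)
      (Ici r) r :=
    (continuous_of_discreteTopology
      (f := fun n : ℕ => ∑ i ∈ Finset.range (k n), γ i ω)).continuousAt.comp_continuousWithinAt h1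
  exact ((hW.comp continuous_real_toNNReal).const_mul σ).continuousWithinAt.add h2

theorem measurable_noise (h : IsDrivingNoise P W N γ ν γbar) (σ : ℝ) (k : ℕ → ℕ) (r : ℝ) :
    Measurable (noise σ W N γ k r) :=
  PowerDemand.measurable_noise (h.measurable_W _) (h.poisson.measurable _)
    fun _ i _ => h.measurable_γ i

theorem pastInfo_le (h : IsDrivingNoise P W N γ ν γbar) (s : ℝ≥0) :
    pastInfo W N γ s ≤ ‹MeasurableSpace Ω› :=
  sup_le (sup_le (Measurable.comap_le (measurable_pi_lambda _ fun v => h.measurable_W v))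
    (Measurable.comap_le (measurable_pi_lambda _ fun v => h.poisson.measurable v)))
    (Measurable.comap_le (measurable_pi_lambda _ fun i => h.measurable_γ i))

theorem jumpInfo_le (h : IsDrivingNoise P W N γ ν γbar) (i : ℕ) :
    jumpInfo W N γ i ≤ ‹MeasurableSpace Ω› :=
  sup_le (Measurable.comap_le (measurable_pi_lambda _ fun j => h.measurable_γ j))
    (Measurable.comap_le ((measurable_pi_lambda _ fun v => h.measurable_W v).prodMk
      (measurable_pi_lambda _ fun v => h.poisson.measurable v)))

/-! ### Moments and independence of the noise -/

theorem hasLaw_N (h : IsDrivingNoise P W N γ ν γbar) (t : ℝ≥0) :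
    HasLaw (N t) (poissonMeasure (ν * t)) P := by
  have := h.poisson.law 0 t zero_le
  rw [tsub_zero] at this
  refine this.congr ?_
  filter_upwards [h.poisson.zero] with ω hω
  simp [hω]

theorem integral_N_increment (h : IsDrivingNoise P W N γ ν γbar) {s r : ℝ≥0} (hsr : s ≤ r) :
    ∫ ω, ((N r ω - N s ω : ℕ) : ℝ) ∂P = ν * (r - s) := by
  have := (h.poisson.law s r hsr).integral_comp (f := fun n : ℕ => (n : ℝ)) (by fun_prop)
  simp only [Function.comp_def] at this
  rw [this, integral_poissonMeasure_natCast]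
  push_cast [NNReal.coe_sub hsr]
  rfl

theorem memLp_W (h : IsDrivingNoise P W N γ ν γbar) (t : ℝ≥0) : MemLp (W t) 2 P :=
  (h.brownian.hasLaw_eval t).hasGaussianLaw.memLp_two

theorem memLp_N (h : IsDrivingNoise P W N γ ν γbar) (t : ℝ≥0) :
    MemLp (fun ω => (N t ω : ℝ)) 2 P := by
  have hm : Measurable fun ω => (N t ω : ℝ) := measurable_from_nat.comp (h.poisson.measurable t)
  rw [memLp_two_iff_integrable_sq hm.aestronglyMeasurable]
  have := integrable_sq_poissonMeasure (ν * t)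
  rw [← (h.hasLaw_N t).map_eq, integrable_map_measure (by fun_prop)
    (h.poisson.measurable t).aemeasurable] at this
  exact this

/-- By the Cauchy-Schwarz inequality the square of the sum is at most `N t * ∑ γ i ^ 2`, and the
jump heights are independent of `N`: the second moment is at most `E[N t ^ 2] E[γ 0 ^ 2]`. -/
theorem memLp_sum_abs_jumps (h : IsDrivingNoise P W N γ ν γbar) (t : ℝ≥0) :
    MemLp (fun ω => ∑ i ∈ Finset.range (N t ω), |γ i ω|) 2 P := by
  have hm : Measurable fun ω => ∑ i ∈ Finset.range (N t ω), |γ i ω| :=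
    measurable_random_index (f := fun n ω => ∑ i ∈ Finset.range n, |γ i ω|)
      (fun n => Finset.measurable_sum _ fun i _ => (h.measurable_γ i).abs) (h.poisson.measurable t)
  refine ⟨hm.aestronglyMeasurable, ?_⟩
  rw [eLpNorm_lt_top_iff_lintegral_rpow_enorm_lt_top (by norm_num) (by norm_num)]
  have hbound : ∀ ω, ‖∑ i ∈ Finset.range (N t ω), |γ i ω|‖ₑ ^ (2 : ℝ≥0∞).toReal
      ≤ ∑' i, (if i < N t ω then (N t ω : ℝ≥0∞) else 0) * ENNReal.ofReal (γ i ω ^ 2) := by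
    intro ω
    have hsq := sq_sum_le_card_mul_sum_sq (s := Finset.range (N t ω)) (f := fun i => |γ i ω|)
    simp only [sq_abs, Finset.card_range] at hsq
    have hs0 : 0 ≤ ∑ i ∈ Finset.range (N t ω), |γ i ω| :=
      Finset.sum_nonneg fun _ _ => abs_nonneg _
    rw [Real.enorm_of_nonneg hs0, ENNReal.toReal_ofNat, ENNReal.rpow_ofNat,
      ← ENNReal.ofReal_pow hs0]
    refine (ENNReal.ofReal_le_ofReal hsq).trans ?_
    rw [ENNReal.ofReal_mul (by positivity), ENNReal.ofReal_natCast,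
      ENNReal.ofReal_sum_of_nonneg fun _ _ => sq_nonneg _, Finset.mul_sum]
    refine le_trans (le_of_eq ?_) (ENNReal.sum_le_tsum (Finset.range (N t ω)))
    exact Finset.sum_congr rfl fun i hi => by rw [if_pos (Finset.mem_range.1 hi)]
  refine (lintegral_mono hbound).trans_lt ?_
  have hmN : ∀ i, Measurable[MeasurableSpace.comap
      (fun ω => ((fun t => W t ω), (fun t => N t ω))) inferInstance]
      fun ω => if i < N t ω then (N t ω : ℝ≥0∞) else 0 := fun i =>
    (measurable_of_countable fun n : ℕ => if i < n then (n : ℝ≥0∞) else 0).comp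
      ((measurable_N_comap N t).mono (comap_N_le W N) le_rfl)
  have hle : MeasurableSpace.comap (fun ω => ((fun t => W t ω), (fun t => N t ω))) inferInstance
      ≤ ‹MeasurableSpace Ω› := le_sup_right.trans (h.jumpInfo_le 0)
  have hmγ : ∀ i, Measurable[MeasurableSpace.comap (fun ω i => γ i ω) inferInstance]
      fun ω => ENNReal.ofReal (γ i ω ^ 2) := fun i =>
    ((((measurable_pi_apply (X := fun _ : ℕ => ℝ) i).comp
      (comap_measurable (fun ω i => γ i ω)))).pow_const 2).ennreal_ofReal
  have hleγ : MeasurableSpace.comap (fun ω i => γ i ω) inferInstance ≤ ‹MeasurableSpace Ω› :=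
    Measurable.comap_le (measurable_pi_lambda _ fun i => h.measurable_γ i)
  have hmN' := fun i => (hmN i).mono hle le_rfl
  have hmγ' := fun i => (hmγ i).mono hleγ le_rfl
  rw [lintegral_tsum fun i => (Measurable.fun_mul (hmN' i) (hmγ' i)).aemeasurable]
  have hterm : ∀ i, ∫⁻ ω, (if i < N t ω then (N t ω : ℝ≥0∞) else 0) * ENNReal.ofReal (γ i ω ^ 2) ∂P
      = (∫⁻ ω, (if i < N t ω then (N t ω : ℝ≥0∞) else 0) ∂P)
        * ∫⁻ ω, ENNReal.ofReal (γ 0 ω ^ 2) ∂P := by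
    intro i
    rw [lintegral_mul_eq_lintegral_mul_lintegral_of_independent_measurableSpace hle hleγ
      h.indep_γ.symm (hmN i) (hmγ i)]
    congr 1
    exact ((h.ident_γ i).comp (u := fun x : ℝ => ENNReal.ofReal (x ^ 2))
      (by fun_prop)).lintegral_eq
  simp_rw [hterm]
  rw [ENNReal.tsum_mul_right, ← lintegral_tsum fun i => (hmN' i).aemeasurable]
  have hN2 : ∀ ω, ∑' i, (if i < N t ω then (N t ω : ℝ≥0∞) else 0)
      = ENNReal.ofReal ((N t ω : ℝ) ^ 2) := by
    intro ω
    rw [tsum_eq_sum (s := Finset.range (N t ω)) fun i hi => if_neg (by simpa using hi),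
      Finset.sum_congr rfl fun i hi => if_pos (Finset.mem_range.1 hi), Finset.sum_const,
      Finset.card_range, nsmul_eq_mul, ENNReal.ofReal_pow (by positivity), ENNReal.ofReal_natCast,
      sq]
  simp_rw [hN2]
  exact ENNReal.mul_lt_top (h.memLp_N t).integrable_sq.lintegral_lt_top
    h.memLp_γ.integrable_sq.lintegral_lt_top

variable [IsProbabilityMeasure P]

theorem indep_W_increment (h : IsDrivingNoise P W N γ ν γbar) {s r : ℝ≥0} (hsr : s ≤ r) :
    Indep (MeasurableSpace.comap (fun ω => W r ω - W s ω) inferInstance) (pastInfo W N γ s) P := by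
  have hx : MeasurableSpace.comap (fun ω => W r ω - W s ω) inferInstance
      ≤ MeasurableSpace.comap (fun ω t => W t ω) inferInstance :=
    Measurable.comap_le ((measurable_W_comap W r).sub (measurable_W_comap W s))
  have hpW := comap_pi_restrict_le W (Iic s)
  have hpN := comap_pi_restrict_le N (Iic s)
  have hWle : MeasurableSpace.comap (fun ω t => W t ω) inferInstance ≤ ‹MeasurableSpace Ω› :=
    Measurable.comap_le (measurable_pi_lambda _ fun v => h.measurable_W v)
  have hNle : MeasurableSpace.comap (fun ω t => N t ω) inferInstance ≤ ‹MeasurableSpace Ω› :=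
    Measurable.comap_le (measurable_pi_lambda _ fun v => h.poisson.measurable v)
  have hγle : MeasurableSpace.comap (fun ω i => γ i ω) inferInstance ≤ ‹MeasurableSpace Ω› :=
    Measurable.comap_le (measurable_pi_lambda _ fun i => h.measurable_γ i)
  have h0 : Indep (MeasurableSpace.comap (fun ω => W r ω - W s ω) inferInstance)
      (MeasurableSpace.comap (fun ω (v : Iic s) => W v ω) inferInstance) P := by
    have := (h.brownian.indepFun_shift s).comp (measurable_pi_apply (r - s)) measurable_id
    simp only [Function.comp_def, add_tsub_cancel_of_le hsr] at this
    exact this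
  refine indep_sup_right (hx.trans hWle) (sup_le (hpW.trans hWle) (hpN.trans hNle)) hγle ?_ ?_
  · refine indep_sup_right (hx.trans hWle) (hpW.trans hWle) (hpN.trans hNle) h0 ?_
    exact indep_of_indep_of_le_left (indep_of_indep_of_le_right h.indep_W_N hpN) (sup_le hx hpW)
  · refine indep_of_indep_of_le_left h.indep_γ.symm (sup_le ?_ (sup_le ?_ ?_))
    · exact hx.trans (comap_W_le W N)
    · exact hpW.trans (comap_W_le W N)
    · exact hpN.trans (comap_N_le W N)

theorem indep_N_increment (h : IsDrivingNoise P W N γ ν γbar) {s r : ℝ≥0} (hsr : s ≤ r) :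
    Indep (MeasurableSpace.comap (fun ω => N r ω - N s ω) inferInstance) (pastInfo W N γ s) P := by
  have hx : MeasurableSpace.comap (fun ω => N r ω - N s ω) inferInstance
      ≤ MeasurableSpace.comap (fun ω t => N t ω) inferInstance :=
    Measurable.comap_le ((measurable_N_comap N r).sub (measurable_N_comap N s))
  have hpW := comap_pi_restrict_le W (Iic s)
  have hpN := comap_pi_restrict_le N (Iic s)
  have hWle : MeasurableSpace.comap (fun ω t => W t ω) inferInstance ≤ ‹MeasurableSpace Ω› :=
    Measurable.comap_le (measurable_pi_lambda _ fun v => h.measurable_W v)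
  have hNle : MeasurableSpace.comap (fun ω t => N t ω) inferInstance ≤ ‹MeasurableSpace Ω› :=
    Measurable.comap_le (measurable_pi_lambda _ fun v => h.poisson.measurable v)
  have hγle : MeasurableSpace.comap (fun ω i => γ i ω) inferInstance ≤ ‹MeasurableSpace Ω› :=
    Measurable.comap_le (measurable_pi_lambda _ fun i => h.measurable_γ i)
  refine indep_sup_right (hx.trans hNle) (sup_le (hpW.trans hWle) (hpN.trans hNle)) hγle ?_ ?_
  · rw [sup_comm]
    refine indep_sup_right (hx.trans hNle) (hpN.trans hNle) (hpW.trans hWle)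
      (h.poisson.indepFun_increment hsr) ?_
    exact indep_of_indep_of_le_left (indep_of_indep_of_le_right h.indep_W_N.symm hpW)
      (sup_le hx hpN)
  · refine indep_of_indep_of_le_left h.indep_γ.symm (sup_le ?_ (sup_le ?_ ?_))
    · exact hx.trans (comap_N_le W N)
    · exact hpW.trans (comap_W_le W N)
    · exact hpN.trans (comap_N_le W N)

theorem indep_jump (h : IsDrivingNoise P W N γ ν γbar) (i : ℕ) :
    Indep (MeasurableSpace.comap (γ i) inferInstance) (jumpInfo W N γ i) P := by
  have hγi : Measurable[MeasurableSpace.comap (fun ω i => γ i ω) inferInstance] (γ i) :=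
    (measurable_pi_apply (X := fun _ : ℕ => ℝ) i).comp (comap_measurable (fun ω i => γ i ω))
  have hpγ : MeasurableSpace.comap (fun ω (j : Finset.range i) => γ j ω) inferInstance
      ≤ MeasurableSpace.comap (fun ω i => γ i ω) inferInstance :=
    comap_pi_restrict_le γ (Finset.range i : Set ℕ)
  have hγle : MeasurableSpace.comap (fun ω i => γ i ω) inferInstance ≤ ‹MeasurableSpace Ω› :=
    Measurable.comap_le (measurable_pi_lambda _ fun i => h.measurable_γ i)
  refine indep_sup_right (h.measurable_γ i).comap_le (hpγ.trans hγle)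
    (le_sup_right.trans (h.jumpInfo_le 0)) ?_ ?_
  · exact (h.iIndep_γ.indepFun_finset {i} (Finset.range i) (by simp) h.measurable_γ).comp
      (measurable_pi_apply (X := fun _ : ({i} : Finset ℕ) => ℝ) ⟨i, by simp⟩) measurable_id
  · exact indep_of_indep_of_le_left h.indep_γ (sup_le hγi.comap_le hpγ)

theorem integral_W_sq (h : IsDrivingNoise P W N γ ν γbar) (t : ℝ≥0) :
    ∫ ω, W t ω ^ 2 ∂P = t := by
  have h1 := (h.brownian.hasLaw_eval t).variance_eq
  rw [variance_id_gaussianReal, variance_eq_sub (h.memLp_W t), h.brownian.integral_eval] at h1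
  simpa using h1

/-- The noise is bounded in `L²` on bounded time intervals. -/
theorem exists_eLpNorm_noise_le (h : IsDrivingNoise P W N γ ν γbar) (σ T : ℝ) :
    ∃ K : ℝ≥0∞, K < ∞ ∧ ∀ r ≤ T, eLpNorm (noise σ W N γ id r) 2 P ≤ K := by
  refine ⟨ENNReal.ofReal |σ| * ENNReal.ofReal (T.toNNReal : ℝ) ^ (1 / 2 : ℝ)
    + eLpNorm (fun ω => ∑ i ∈ Finset.range (N T.toNNReal ω), |γ i ω|) 2 P, ?_, fun r hr => ?_⟩
  · refine ENNReal.add_lt_top.2 ⟨ENNReal.mul_lt_top ENNReal.ofReal_lt_top ?_,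
      (h.memLp_sum_abs_jumps _).2⟩
    exact ENNReal.rpow_lt_top_of_nonneg (by norm_num) ENNReal.ofReal_ne_top
  · have hm : Measurable fun ω => ∑ i ∈ Finset.range (N r.toNNReal ω), γ i ω :=
      measurable_random_index (f := fun n ω => ∑ i ∈ Finset.range n, γ i ω)
        (fun n => Finset.measurable_sum _ fun i _ => h.measurable_γ i)
        (h.poisson.measurable _)
    refine (eLpNorm_add_le ((h.measurable_W _).const_mul σ).aestronglyMeasurable
      hm.aestronglyMeasurable one_le_two).trans (add_le_add ?_ ?_)
    · have := eLpNorm_const_smul_le (c := σ) (f := W r.toNNReal) (p := 2) (μ := P)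
      refine this.trans ?_
      rw [← ofReal_norm, Real.norm_eq_abs]
      gcongr
      rw [eLpNorm_eq_lintegral_rpow_enorm_toReal (by norm_num) (by norm_num)]
      have he : ∫⁻ ω, ‖W r.toNNReal ω‖ₑ ^ (2 : ℝ≥0∞).toReal ∂P
          = ENNReal.ofReal (r.toNNReal : ℝ) := by
        rw [← h.integral_W_sq, ofReal_integral_eq_lintegral_ofReal (h.memLp_W _).integrable_sq
          (Filter.Eventually.of_forall fun _ => sq_nonneg _)]
        congr 1
        funext ω
        rw [ENNReal.toReal_ofNat, ENNReal.rpow_ofNat, ← ofReal_norm,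
          ← ENNReal.ofReal_pow (norm_nonneg _), Real.norm_eq_abs, sq_abs]
      rw [he, ENNReal.toReal_ofNat]
      gcongr
    · refine eLpNorm_mono_ae ?_
      filter_upwards [h.poisson.mono] with ω hω
      rw [Real.norm_eq_abs, Real.norm_eq_abs]
      refine (Finset.abs_sum_le_sum_abs _ _).trans (le_trans ?_ (le_abs_self _))
      exact Finset.sum_le_sum_of_subset_of_nonneg
        (Finset.range_mono (hω (Real.toNNReal_mono hr))) fun _ _ _ => abs_nonneg _

end IsDrivingNoise

end

/-! ### The mean of the noise increments on past events -/

namespace IsDrivingNoise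

variable {Ω : Type*} [MeasurableSpace Ω] {P : Measure Ω} [IsProbabilityMeasure P]
  {W : ℝ≥0 → Ω → ℝ} {N : ℝ≥0 → Ω → ℕ} {γ : ℕ → Ω → ℝ} {ν : ℝ≥0} {γbar : ℝ}

/-- The jumps in `(s, r]` have mean `γbar ν (r - s)` on an event `A` of the past up to time `s`. The
event need not be independent of the jump heights, since the past sees the first `N_s` of them. Two
properties of `A` are used: on `{N_s ≤ i}` it does not see the jump height `γ_i`, and it is
independent of the number of jumps in `(s, r]`. -/
theorem setIntegral_jumps (h : IsDrivingNoise P W N γ ν γbar) {s r : ℝ≥0} (hsr : s ≤ r)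
    {A : Set Ω}
    (hpast : ∃ A', MeasurableSet[pastInfo W N γ s] A' ∧ ∀ᵐ ω ∂P, ω ∈ A ↔ ω ∈ A')
    (hjump : ∀ i, ∃ A', MeasurableSet[jumpInfo W N γ i] A' ∧
      ∀ᵐ ω ∂P, N s ω ≤ i → (ω ∈ A ↔ ω ∈ A')) :
    ∫ ω in A, (∑ i ∈ Finset.range (N r ω), γ i ω - ∑ i ∈ Finset.range (N s ω), γ i ω) ∂P
      = γbar * ν * (r - s) * P.real A := by
  let B : ℕ → Set Ω := fun i => {ω | N s ω ≤ i ∧ i < N r ω}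
  have hBm : ∀ i, MeasurableSet[jumpInfo W N γ i] (B i) := fun i =>
    ((measurable_N_jumpInfo i s) (measurableSet_Iic (a := i))).inter
      ((measurable_N_jumpInfo i r) (measurableSet_Ioi (a := i)))
  have hBm' : ∀ i, MeasurableSet (B i) := fun i => h.jumpInfo_le i _ (hBm i)
  have hγi : ∀ i, Integrable (γ i) P := fun i =>
    ((h.ident_γ i).memLp_iff.2 h.memLp_γ).integrable one_le_two
  have hγmean : ∀ i, ∫ ω, γ i ω ∂P = γbar := fun i => by
    rw [(h.ident_γ i).integral_eq, h.mean_γ]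
  -- each jump height is independent of the part of `A` on which it is the height of a jump in
  -- `(s, r]`
  have hterm : ∀ i, ∫ ω in A, (B i).indicator (γ i) ω ∂P
      = γbar * ∫ ω in A, (B i).indicator (fun _ => (1 : ℝ)) ω ∂P := by
    intro i
    obtain ⟨A', hA', hAA'⟩ := hjump i
    have hset : (A ∩ B i : Set Ω) =ᵐ[P] (A' ∩ B i : Set Ω) := by
      filter_upwards [hAA'] with ω hω
      refine propext ⟨fun hx => ⟨(hω hx.2.1).1 hx.1, hx.2⟩, fun hx => ⟨(hω hx.2.1).2 hx.1, hx.2⟩⟩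
    have hm : MeasurableSet[jumpInfo W N γ i] (A' ∩ B i) := hA'.inter (hBm i)
    rw [setIntegral_indicator (hBm' i), setIntegral_indicator (hBm' i),
      setIntegral_congr_set hset, setIntegral_congr_set hset,
      setIntegral_eq_of_indep (h.measurable_γ i).comap_le (h.jumpInfo_le i) (h.indep_jump i)
        (comap_measurable _) (hγi i) hm, hγmean, setIntegral_const]
    simp [mul_comm]
  have hmono : ∀ᵐ ω ∂P, N s ω ≤ N r ω := h.poisson.mono.mono fun ω hω => hω hsr
  -- dominated convergence for the partial sums over `i < n`
  have hpart : ∀ (g : ℕ → Ω → ℝ) (n : ℕ) (ω : Ω), N s ω ≤ N r ω →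
      ∑ i ∈ Finset.range n, (B i).indicator (g i) ω
        = ∑ i ∈ Finset.Ico (N s ω) (min n (N r ω)), g i ω := by
    intro g n ω _
    simp only [indicator_apply, B, mem_ofPred_eq]
    rw [← Finset.sum_filter]
    refine Finset.sum_congr ?_ fun _ _ => rfl
    ext i
    simp only [Finset.mem_filter, Finset.mem_range, Finset.mem_Ico, lt_min_iff]
    tauto
  have hlim : ∀ g : ℕ → Ω → ℝ, (∀ i, Measurable (g i)) →
      Integrable (fun ω => ∑ i ∈ Finset.range (N r ω), |g i ω|) P →
      Filter.Tendsto (fun n => ∫ ω in A, ∑ i ∈ Finset.range n, (B i).indicator (g i) ω ∂P)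
        Filter.atTop (nhds (∫ ω in A, ∑ i ∈ Finset.Ico (N s ω) (N r ω), g i ω ∂P)) := by
    intro g hg hgi
    refine tendsto_integral_of_dominated_convergence
      (fun ω => ∑ i ∈ Finset.range (N r ω), |g i ω|)
      (fun n => (Finset.measurable_sum _ fun i _ =>
        (hg i).indicator (hBm' i)).aestronglyMeasurable) hgi.integrableOn
      (fun n => ae_restrict_of_ae ?_) (ae_restrict_of_ae ?_)
    · filter_upwards [hmono] with ω hω
      rw [hpart g n ω hω, Real.norm_eq_abs]
      refine (Finset.abs_sum_le_sum_abs _ _).trans ?_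
      refine Finset.sum_le_sum_of_subset_of_nonneg (fun i hi => ?_) fun _ _ _ => abs_nonneg _
      simp only [Finset.mem_Ico, lt_min_iff] at hi
      exact Finset.mem_range.2 hi.2.2
    · filter_upwards [hmono] with ω hω
      refine tendsto_const_nhds.congr' ?_
      filter_upwards [Filter.eventually_ge_atTop (N r ω)] with n hn
      rw [hpart g n ω hω, min_eq_right hn]
  have h1 := hlim γ h.measurable_γ ((h.memLp_sum_abs_jumps r).integrable one_le_two)
  have h2 := hlim (fun _ _ => 1) (fun _ => measurable_const)
    (by simpa using (h.memLp_N r).integrable one_le_two)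
  have hsum : ∀ n, ∫ ω in A, ∑ i ∈ Finset.range n, (B i).indicator (γ i) ω ∂P
      = γbar * ∫ ω in A, ∑ i ∈ Finset.range n, (B i).indicator (fun _ => (1 : ℝ)) ω ∂P := by
    intro n
    rw [integral_finsetSum _ fun i _ => ((hγi i).indicator (hBm' i)).integrableOn.integrable,
      integral_finsetSum _ fun i _ =>
        ((integrable_const (1 : ℝ)).indicator (hBm' i)).integrableOn.integrable,
      Finset.mul_sum]
    exact Finset.sum_congr rfl fun i _ => hterm i
  have h3 := tendsto_nhds_unique h1 ((h2.const_mul γbar).congr fun n => (hsum n).symm)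
  have h4 : ∫ ω in A, (∑ i ∈ Finset.range (N r ω), γ i ω - ∑ i ∈ Finset.range (N s ω), γ i ω) ∂P
      = ∫ ω in A, ∑ i ∈ Finset.Ico (N s ω) (N r ω), γ i ω ∂P := by
    refine integral_congr_ae (ae_restrict_of_ae ?_)
    filter_upwards [hmono] with ω hω
    rw [Finset.sum_Ico_eq_sub _ hω]
  have h5 : ∫ ω in A, ∑ i ∈ Finset.Ico (N s ω) (N r ω), (1 : ℝ) ∂P
      = P.real A * (ν * (r - s)) := by
    obtain ⟨A', hA', hAA'⟩ := hpast
    have hset : A =ᵐ[P] A' := hAA'.mono fun ω hω => propext hω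
    have hi : Integrable (fun ω => ((N r ω - N s ω : ℕ) : ℝ)) P := by
      refine ((h.memLp_N r).integrable one_le_two).mono'
        (measurable_from_nat.comp ((h.poisson.measurable r).sub
          (h.poisson.measurable s))).aestronglyMeasurable (Filter.Eventually.of_forall fun ω => ?_)
      rw [Real.norm_of_nonneg (Nat.cast_nonneg _)]
      exact_mod_cast Nat.sub_le _ _
    have hind := setIntegral_eq_of_indep (f := fun ω => ((N r ω - N s ω : ℕ) : ℝ))
      ((h.poisson.measurable r).sub (h.poisson.measurable s)).comap_le
      (h.pastInfo_le s) (h.indep_N_increment hsr)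
      (measurable_from_nat.comp (comap_measurable _)) hi hA'
    simp only [Finset.sum_const, Nat.card_Ico, nsmul_eq_mul, mul_one]
    rw [setIntegral_congr_set hset, measureReal_congr hset, hind, h.integral_N_increment hsr]
  rw [h4, h3, h5]
  ring

theorem setIntegral_noise_increment (h : IsDrivingNoise P W N γ ν γbar) (σ : ℝ) {s r : ℝ}
    (hs : 0 ≤ s) (hsr : s ≤ r) {A : Set Ω}
    (hpast : ∃ A', MeasurableSet[pastInfo W N γ s.toNNReal] A' ∧ ∀ᵐ ω ∂P, ω ∈ A ↔ ω ∈ A')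
    (hjump : ∀ i, ∃ A', MeasurableSet[jumpInfo W N γ i] A' ∧
      ∀ᵐ ω ∂P, N s.toNNReal ω ≤ i → (ω ∈ A ↔ ω ∈ A')) :
    ∫ ω in A, (noise σ W N γ id r ω - noise σ W N γ id s ω) ∂P
      = γbar * ν * (r - s) * P.real A := by
  have hsr' : s.toNNReal ≤ r.toNNReal := Real.toNNReal_mono hsr
  have hJ : ∀ t, Integrable (fun ω => ∑ i ∈ Finset.range (N t ω), γ i ω) P := by
    intro t
    refine ((h.memLp_sum_abs_jumps t).integrable one_le_two).mono'
      (measurable_random_index (f := fun n ω => ∑ i ∈ Finset.range n, γ i ω)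
        (fun n => Finset.measurable_sum _ fun i _ => h.measurable_γ i)
        (h.poisson.measurable t)).aestronglyMeasurable (Filter.Eventually.of_forall fun ω => ?_)
    exact Finset.abs_sum_le_sum_abs _ _
  have hW : ∀ t, Integrable (W t) P := fun t => (h.memLp_W t).integrable one_le_two
  have hsplit : ∀ ω, noise σ W N γ id r ω - noise σ W N γ id s ω
      = σ * (W r.toNNReal ω - W s.toNNReal ω)
        + (∑ i ∈ Finset.range (N r.toNNReal ω), γ i ω
          - ∑ i ∈ Finset.range (N s.toNNReal ω), γ i ω) := by
    intro ω
    simp only [noise, id]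
    ring
  have hWi : Integrable (fun ω => W r.toNNReal ω - W s.toNNReal ω) P := (hW _).sub (hW _)
  have hJi : Integrable (fun ω => ∑ i ∈ Finset.range (N r.toNNReal ω), γ i ω
      - ∑ i ∈ Finset.range (N s.toNNReal ω), γ i ω) P := (hJ _).sub (hJ _)
  have hWA : ∫ ω in A, (W r.toNNReal ω - W s.toNNReal ω) ∂P = 0 := by
    obtain ⟨A', hA', hAA'⟩ := hpast
    have hset : A =ᵐ[P] A' := hAA'.mono fun ω hω => propext hω
    have hind := setIntegral_eq_of_indep (f := fun ω => W r.toNNReal ω - W s.toNNReal ω)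
      ((h.measurable_W _).sub (h.measurable_W _)).comap_le
      (h.pastInfo_le _) (h.indep_W_increment hsr') (comap_measurable _) hWi hA'
    rw [setIntegral_congr_set hset, hind,
      integral_sub (hW _) (hW _), h.brownian.integral_eval, h.brownian.integral_eval]
    simp
  simp_rw [hsplit]
  rw [integral_add (hWi.const_mul σ).integrableOn hJi.integrableOn,
    integral_const_mul, hWA, h.setIntegral_jumps hsr' hpast hjump, Real.coe_toNNReal _ hs,
    Real.coe_toNNReal _ (hs.trans hsr)]
  ring

end IsDrivingNoise

/-! ### The demand process -/

theorem memLp_two_prod_of_eLpNorm_le {α Ω : Type*} {mα : MeasurableSpace α}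
    {mΩ : MeasurableSpace Ω} {ρ : Measure α} [IsFiniteMeasure ρ] {P : Measure Ω} [SFinite P]
    {F : α × Ω → ℝ} (hF : AEStronglyMeasurable F (ρ.prod P)) {K : ℝ≥0∞} (hK : K < ∞)
    (h : ∀ᵐ r ∂ρ, eLpNorm (fun ω => F (r, ω)) 2 P ≤ K) : MemLp F 2 (ρ.prod P) := by
  refine ⟨hF, ?_⟩
  rw [eLpNorm_lt_top_iff_lintegral_rpow_enorm_lt_top (by norm_num) (by norm_num),
    lintegral_prod _ (hF.enorm.pow_const _)]
  have hb : ∀ᵐ r ∂ρ, ∫⁻ ω, ‖F (r, ω)‖ₑ ^ (2 : ℝ≥0∞).toReal ∂P ≤ K ^ (2 : ℝ) := by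
    filter_upwards [h] with r hr
    rw [eLpNorm_eq_lintegral_rpow_enorm_toReal (by norm_num) (by norm_num)] at hr
    have := ENNReal.rpow_le_rpow hr (zero_le_two (α := ℝ))
    rwa [← ENNReal.rpow_mul, ENNReal.toReal_ofNat, one_div_mul_cancel two_ne_zero,
      ENNReal.rpow_one] at this
  refine (lintegral_mono_ae hb).trans_lt ?_
  rw [lintegral_const]
  exact ENNReal.mul_lt_top (ENNReal.rpow_lt_top_of_nonneg zero_le_two hK.ne)
    (measure_lt_top _ _)

theorem measurable_integral_exp_mul {Ω : Type*} {m : MeasurableSpace Ω} (κ : ℝ) {u : ℝ}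
    (hu : 0 ≤ u) {X : ℝ × Ω → ℝ} (hX : StronglyMeasurable X) :
    Measurable fun ω => ∫ r in (0 : ℝ)..u, Real.exp (-κ * (u - r)) * X (r, ω) := by
  simp only [intervalIntegral.integral_of_le hu]
  have h1 : StronglyMeasurable fun p : ℝ × Ω => Real.exp (-κ * (u - p.1)) * X p := by
    refine StronglyMeasurable.mul (Measurable.stronglyMeasurable ?_) hX
    fun_prop
  exact (StronglyMeasurable.integral_prod_left' h1).measurable

namespace IsDemand

section

variable {Ω : Type*} [MeasurableSpace Ω] {P : Measure Ω}
  {W : ℝ≥0 → Ω → ℝ} {N : ℝ≥0 → Ω → ℕ} {γ : ℕ → Ω → ℝ} {ν : ℝ≥0} {γbar : ℝ}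
  {κ σ y₀ T : ℝ} {μ : ℝ → ℝ} {Y : ℝ → Ω → ℝ}

/-- The paths of the demand are explicit functionals of the paths of the noise. -/
theorem ae_eq_noise (hY : IsDemand P κ σ y₀ T μ W N γ Y) (hμ : IntegrableOn μ (Icc 0 T)) :
    ∀ᵐ ω ∂P, ∀ u ∈ Icc 0 T, Y u ω = Real.exp (-κ * (u - 0)) * y₀
      + κ * (∫ r in (0 : ℝ)..u, Real.exp (-κ * (u - r)) * μ r) + noise σ W N γ id u ω
      - κ * ∫ r in (0 : ℝ)..u, Real.exp (-κ * (u - r)) * noise σ W N γ id r ω := by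
  filter_upwards [hY.integrable_path, hY.equation] with ω hi he u hu
  have hsub : Icc 0 u ⊆ Icc 0 T := Icc_subset_Icc le_rfl hu.2
  refine variation_of_constants (y := fun t => Y t ω) (ℓ := fun r => noise σ W N γ id r ω) hu.1
    ((intervalIntegrable_iff_integrableOn_Icc_of_le hu.1).2 (hμ.mono_set hsub))
    ((intervalIntegrable_iff_integrableOn_Icc_of_le hu.1).2 (hi.mono_set hsub)) fun t ht => ?_
  rw [he t (hsub ht), noise, add_assoc, id]

end

/-- If on the event `B` the noise agrees up to time `s` with a right-continuous process that is
`m`-measurable, then so does the demand, up to null sets. -/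
theorem exists_measurable_of_noise_eq {Ω : Type*} {m mΩ : MeasurableSpace Ω}
    {P : Measure Ω} {W : ℝ≥0 → Ω → ℝ} {N : ℝ≥0 → Ω → ℕ} {γ : ℕ → Ω → ℝ} {κ σ y₀ T : ℝ}
    {μ : ℝ → ℝ} {Y : ℝ → Ω → ℝ}
    (hY : IsDemand P κ σ y₀ T μ W N γ Y) (hμ : IntegrableOn μ (Icc 0 T)) {s : ℝ} (hs : s ≤ T)
    {X : ℝ → Ω → ℝ} (hX : ∀ r, Measurable[m] (X r))
    (hXc : ∀ᵐ ω ∂P, ∀ r, ContinuousWithinAt (fun r => X r ω) (Ici r) r) {B : Set Ω}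
    (hB : ∀ᵐ ω ∂P, ω ∈ B → ∀ r ∈ Icc 0 s, noise σ W N γ id r ω = X r ω) {u : ℝ}
    (hu : u ∈ Icc 0 s) :
    ∃ Z : Ω → ℝ, Measurable[m] Z ∧ ∀ᵐ ω ∂P, ω ∈ B → Y u ω = Z ω := by
  obtain ⟨X', hX'm, hX'⟩ := @exists_stronglyMeasurable_version Ω m X hX
  refine ⟨fun ω => Real.exp (-κ * (u - 0)) * y₀
      + κ * (∫ r in (0 : ℝ)..u, Real.exp (-κ * (u - r)) * μ r) + X u ω
      - κ * ∫ r in (0 : ℝ)..u, Real.exp (-κ * (u - r)) * X' (r, ω), ?_, ?_⟩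
  · have hint : Measurable[m] fun ω => ∫ r in (0 : ℝ)..u, Real.exp (-κ * (u - r)) * X' (r, ω) :=
      measurable_integral_exp_mul κ hu.1 hX'm
    exact ((hX u).const_add _).sub (hint.const_mul κ)
  · filter_upwards [hY.ae_eq_noise hμ, hB, hXc] with ω hω hBω hc hmem
    rw [hω u ⟨hu.1, hu.2.trans hs⟩, hBω hmem u hu]
    congr 2
    refine intervalIntegral.integral_congr fun r hr => ?_
    rw [uIcc_of_le hu.1] at hr
    simp only [hX' ω hc r, hBω hmem r ⟨hr.1, hr.2.trans hu.2⟩]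

section

variable {Ω : Type*} [MeasurableSpace Ω] {P : Measure Ω}
  {W : ℝ≥0 → Ω → ℝ} {N : ℝ≥0 → Ω → ℕ} {γ : ℕ → Ω → ℝ} {ν : ℝ≥0} {γbar : ℝ}
  {κ σ y₀ T : ℝ} {μ : ℝ → ℝ} {Y : ℝ → Ω → ℝ}

/-- Events of the past of the demand are almost surely events of `pastInfo`: the demand up to time
`s` is a functional of the noise stopped at `s`. -/
theorem exists_pastInfo (hY : IsDemand P κ σ y₀ T μ W N γ Y) (h : IsDrivingNoise P W N γ ν γbar)
    (hμ : IntegrableOn μ (Icc 0 T)) {s : ℝ} (hs : s ≤ T) {A : Set Ω}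
    (hA : MeasurableSet[demandInfo Y s] A) :
    ∃ A', MeasurableSet[pastInfo W N γ s.toNNReal] A' ∧ ∀ᵐ ω ∂P, ω ∈ A ↔ ω ∈ A' := by
  obtain ⟨A', hA', hAA'⟩ := exists_measurableSet_of_iSup_comap (P := P) (B := univ)
    (m := pastInfo W N γ s.toNNReal) (fun u hu =>
      hY.exists_measurable_of_noise_eq hμ hs (X := fun r => noise σ W N γ id (min r s))
        (fun r => measurable_noise (measurable_W_pastInfo (Real.toNNReal_mono (min_le_right _ _)))
          (measurable_N_pastInfo (Real.toNNReal_mono (min_le_right _ _)))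
          fun _ i _ => measurable_γ_pastInfo _ i) (by
        filter_upwards [h.noise_rightCont σ] with ω hω r
        exact (hω id (min r s)).comp (f := fun r => min r s) (by fun_prop)
          fun x hx => min_le_min_right s hx)
        (Filter.Eventually.of_forall fun ω _ r hr => by rw [min_eq_left hr.2]) hu) hA
  exact ⟨A', hA', by simpa using hAA'⟩

/-- As long as at most `i` jumps have occurred, the past of the demand is seen by `jumpInfo`: there
the noise agrees with the one that drops all jumps after the first `i`. -/
theorem exists_jumpInfo (hY : IsDemand P κ σ y₀ T μ W N γ Y) (h : IsDrivingNoise P W N γ ν γbar)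
    (hμ : IntegrableOn μ (Icc 0 T)) {s : ℝ} (hs : s ≤ T) {A : Set Ω}
    (hA : MeasurableSet[demandInfo Y s] A) (i : ℕ) :
    ∃ A', MeasurableSet[jumpInfo W N γ i] A' ∧
      ∀ᵐ ω ∂P, N s.toNNReal ω ≤ i → (ω ∈ A ↔ ω ∈ A') := by
  refine exists_measurableSet_of_iSup_comap (P := P) (B := {ω | N s.toNNReal ω ≤ i})
    (m := jumpInfo W N γ i) (fun u hu =>
      hY.exists_measurable_of_noise_eq hμ hs (X := noise σ W N γ (min i))
        (fun r => measurable_noise (measurable_W_jumpInfo i _) (measurable_N_jumpInfo i _)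
          fun n j hj => measurable_γ_jumpInfo (hj.trans_le (min_le_left _ _))) ?_ ?_ hu) hA
  · filter_upwards [h.noise_rightCont σ] with ω hω r using hω _ r
  · filter_upwards [h.poisson.mono] with ω hω (hNi : N s.toNNReal ω ≤ i) r hr
    simp only [noise, id]
    rw [min_eq_right ((hω (Real.toNNReal_mono hr.2)).trans hNi)]

/-- The demand has a jointly measurable version, since its paths are right-continuous. -/
theorem exists_version (hY : IsDemand P κ σ y₀ T μ W N γ Y) (h : IsDrivingNoise P W N γ ν γbar)
    (hT : 0 ≤ T) (hμ : IntegrableOn μ (Icc 0 T)) :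
    ∃ Y' : ℝ × Ω → ℝ, StronglyMeasurable Y' ∧ ∀ᵐ ω ∂P, ∀ r ∈ Icc 0 T, Y' (r, ω) = Y r ω := by
  have hclamp : ∀ r : ℝ, max 0 (min r T) ∈ Icc 0 T := fun r =>
    ⟨le_max_left _ _, max_le hT (min_le_right _ _)⟩
  obtain ⟨Y', hY'm, hY'⟩ := exists_stronglyMeasurable_version
    (X := fun r => Y (max 0 (min r T))) fun r => hY.measurable _ (hclamp r)
  refine ⟨Y', hY'm, ?_⟩
  filter_upwards [hY.integrable_path, hY.equation, h.noise_rightCont σ] with ω hi he hc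
  have hg : IntervalIntegrable (fun s => κ * (μ s - Y s ω)) volume 0 T :=
    (((intervalIntegrable_iff_integrableOn_Icc_of_le hT).2 hμ).sub
      ((intervalIntegrable_iff_integrableOn_Icc_of_le hT).2 hi)).const_mul κ
  have hcont : ContinuousOn (fun t => ∫ s in (0 : ℝ)..t, κ * (μ s - Y s ω)) (Icc 0 T) := by
    rw [← uIcc_of_le hT]
    exact intervalIntegral.continuousOn_primitive_interval
      ((intervalIntegrable_iff_integrableOn_Icc_of_le hT).1 hg |>.mono_set
        (by rw [uIcc_of_le hT]))
  intro r hr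
  rw [hY' ω _ r, min_eq_left hr.2, max_eq_right hr.1]
  intro r
  have heq : (fun r => Y (max 0 (min r T)) ω) = fun r =>
      y₀ + (∫ s in (0 : ℝ)..(max 0 (min r T)), κ * (μ s - Y s ω))
        + noise σ W N γ id (max 0 (min r T)) ω := by
    funext r
    rw [he _ (hclamp r), noise, add_assoc, id]
  rw [heq]
  have hcl : Continuous fun r : ℝ => max 0 (min r T) := by fun_prop
  have h1 : Continuous fun r : ℝ => ∫ s in (0 : ℝ)..(max 0 (min r T)), κ * (μ s - Y s ω) :=
    hcont.comp_continuous hcl hclamp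
  refine (continuous_const.add h1).continuousWithinAt.add ?_
  exact (hc id (max 0 (min r T))).comp (f := fun r => max 0 (min r T)) hcl.continuousWithinAt
    fun x hx => max_le_max_left 0 (min_le_min_right T hx)

variable [IsProbabilityMeasure P]

/-- The demand is bounded in `L²`. -/
theorem exists_eLpNorm_le (hY : IsDemand P κ σ y₀ T μ W N γ Y) (h : IsDrivingNoise P W N γ ν γbar)
    (hκ : 0 < κ) (hμ : IntegrableOn μ (Icc 0 T)) :
    ∃ K : ℝ≥0∞, K < ∞ ∧ ∀ t ∈ Icc 0 T, eLpNorm (Y t) 2 P ≤ K := by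
  obtain ⟨K, hK, hKL⟩ := h.exists_eLpNorm_noise_le σ T
  obtain ⟨L', hL'm, hL'⟩ := exists_stronglyMeasurable_version
    (X := noise σ W N γ id) (h.measurable_noise σ id)
  have hL'' : ∀ᵐ ω ∂P, ∀ r, L' (r, ω) = noise σ W N γ id r ω := by
    filter_upwards [h.noise_rightCont σ] with ω hω r using hL' ω (hω id) r
  have hL2 : MemLp L' 2 ((volume.restrict (Icc 0 T)).prod P) := by
    refine memLp_two_prod_of_eLpNorm_le hL'm.aestronglyMeasurable hK ?_
    filter_upwards [ae_restrict_mem measurableSet_Icc] with r hr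
    rw [eLpNorm_congr_ae (hL''.mono fun ω hω => hω r)]
    exact hKL r hr.2
  have hJ := memLp_two_integral_left hL2.norm
  let c : ℝ := |y₀| + κ * ∫ r in Icc 0 T, |μ r|
  have hc0 : 0 ≤ c := add_nonneg (abs_nonneg _)
    (mul_nonneg hκ.le (integral_nonneg fun _ => abs_nonneg _))
  refine ⟨ENNReal.ofReal c + K
    + eLpNorm (fun ω => κ * ∫ r in Icc 0 T, ‖L' (r, ω)‖) 2 P, ?_, fun t ht => ?_⟩
  · exact ENNReal.add_lt_top.2
      ⟨ENNReal.add_lt_top.2 ⟨ENNReal.ofReal_lt_top, hK⟩, (hJ.const_mul κ).2⟩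
  have hint : ∀ᵐ ω ∂P, Integrable (fun r => L' (r, ω)) (volume.restrict (Icc 0 T)) :=
    (hL2.integrable one_le_two).prod_left_ae
  -- the kernel `exp (-κ (t - r))` is at most `1`
  have hkernel : ∀ f : ℝ → ℝ, IntegrableOn f (Icc 0 T) →
      |∫ r in (0 : ℝ)..t, Real.exp (-κ * (t - r)) * f r| ≤ ∫ r in Icc 0 T, |f r| := by
    intro f hf
    refine (intervalIntegral.abs_integral_le_integral_abs ht.1).trans ?_
    rw [intervalIntegral.integral_of_le ht.1, ← integral_Icc_eq_integral_Ioc]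
    have hsub : Icc 0 t ⊆ Icc 0 T := Icc_subset_Icc le_rfl ht.2
    refine (setIntegral_mono_on ?_ (hf.mono_set hsub).abs measurableSet_Icc ?_).trans
      (setIntegral_mono_set hf.abs (Filter.Eventually.of_forall fun _ => abs_nonneg _)
        hsub.eventuallyLE)
    · exact ((hf.mono_set hsub).continuousOn_mul (by fun_prop) isCompact_Icc).abs
    · intro r hr
      rw [abs_mul, Real.abs_exp]
      refine mul_le_of_le_one_left (abs_nonneg _) (Real.exp_le_one_iff.2 ?_)
      nlinarith [hr.2]
  have hYle : ∀ᵐ ω ∂P, ‖Y t ω‖ ≤ ‖(c + |noise σ W N γ id t ω|)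
      + κ * ∫ r in Icc 0 T, ‖L' (r, ω)‖‖ := by
    filter_upwards [hY.ae_eq_noise hμ, hL'', hint] with ω hω hLω hiω
    rw [Real.norm_eq_abs, Real.norm_eq_abs]
    refine le_trans ?_ (le_abs_self _)
    have h1 : ∫ r in (0 : ℝ)..t, Real.exp (-κ * (t - r)) * noise σ W N γ id r ω
        = ∫ r in (0 : ℝ)..t, Real.exp (-κ * (t - r)) * L' (r, ω) := by simp_rw [hLω]
    rw [hω t ht, h1]
    have h2 := hkernel μ hμ
    have h3 := hkernel (fun r => L' (r, ω)) hiω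
    have h4 : |Real.exp (-κ * (t - 0)) * y₀| ≤ |y₀| := by
      rw [abs_mul, Real.abs_exp]
      refine mul_le_of_le_one_left (abs_nonneg _) (Real.exp_le_one_iff.2 ?_)
      nlinarith [ht.1]
    have h5 := mul_le_mul_of_nonneg_left h2 hκ.le
    have h6 := mul_le_mul_of_nonneg_left h3 hκ.le
    rw [← abs_of_pos hκ, ← abs_mul, abs_of_pos hκ] at h5 h6
    refine (abs_sub _ _).trans ((add_le_add ((abs_add_le _ _).trans (add_le_add
      ((abs_add_le _ _).trans (add_le_add h4 h5)) le_rfl)) h6).trans (le_of_eq ?_))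
    rfl
  have hLm : AEStronglyMeasurable (fun ω => |noise σ W N γ id t ω|) P :=
    (h.measurable_noise σ id t).abs.aestronglyMeasurable
  refine (eLpNorm_mono_ae hYle).trans ?_
  refine (eLpNorm_add_le (aestronglyMeasurable_const.add hLm) (hJ.const_mul κ).1
    one_le_two).trans (add_le_add ?_ le_rfl)
  refine (eLpNorm_add_le aestronglyMeasurable_const hLm one_le_two).trans (add_le_add ?_ ?_)
  · rw [eLpNorm_const _ (by norm_num) (IsProbabilityMeasure.ne_zero P)]
    simp only [measure_univ, ENNReal.one_rpow, mul_one]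
    exact (Real.enorm_of_nonneg hc0).le
  · have := eLpNorm_norm (noise σ W N γ id t) (p := 2) (μ := P)
    simp only [Real.norm_eq_abs] at this
    rw [this]
    exact hKL t ht.2

theorem memLp (hY : IsDemand P κ σ y₀ T μ W N γ Y) (h : IsDrivingNoise P W N γ ν γbar)
    (hκ : 0 < κ) (hμ : IntegrableOn μ (Icc 0 T)) {t : ℝ} (ht : t ∈ Icc 0 T) :
    MemLp (Y t) 2 P := by
  obtain ⟨K, hK, hKY⟩ := hY.exists_eLpNorm_le h hκ hμ
  exact ⟨(hY.measurable t ht).aestronglyMeasurable, (hKY t ht).trans_lt hK⟩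

theorem exists_memLp_version (hY : IsDemand P κ σ y₀ T μ W N γ Y)
    (h : IsDrivingNoise P W N γ ν γbar) (hκ : 0 < κ) (hT : 0 ≤ T)
    (hμ : IntegrableOn μ (Icc 0 T)) :
    ∃ Y' : ℝ × Ω → ℝ, StronglyMeasurable Y' ∧ (∀ᵐ ω ∂P, ∀ r ∈ Icc 0 T, Y' (r, ω) = Y r ω) ∧
      MemLp Y' 2 ((volume.restrict (Icc 0 T)).prod P) := by
  obtain ⟨Y', hm, hY'⟩ := hY.exists_version h hT hμ
  obtain ⟨K, hK, hKY⟩ := hY.exists_eLpNorm_le h hκ hμ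
  refine ⟨Y', hm, hY', memLp_two_prod_of_eLpNorm_le hm.aestronglyMeasurable hK ?_⟩
  filter_upwards [ae_restrict_mem measurableSet_Icc] with r hr
  rw [eLpNorm_congr_ae (hY'.mono fun ω hω => hω r hr)]
  exact hKY r hr

end

end IsDemand

/-! ### Conditional expectation of the demand -/

theorem demandInfo_le {Ω : Type*} [MeasurableSpace Ω] {Y : ℝ → Ω → ℝ} {T s : ℝ}
    (hY : ∀ t ∈ Icc 0 T, Measurable (Y t)) (hs : s ≤ T) :
    demandInfo Y s ≤ ‹MeasurableSpace Ω› :=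
  iSup₂_le fun u hu => (hY u ⟨hu.1, hu.2.trans hs⟩).comap_le

theorem measurable_demandInfo {Ω : Type*} (Y : ℝ → Ω → ℝ) {s u : ℝ} (hu : u ∈ Icc 0 s) :
    Measurable[demandInfo Y s] (Y u) :=
  (comap_measurable (Y u)).mono
    (le_iSup₂ (f := fun s' (_ : s' ∈ Icc (0 : ℝ) s) =>
      MeasurableSpace.comap (Y s') inferInstance) u hu) le_rfl

namespace IsDemand

variable {Ω : Type*} [MeasurableSpace Ω] {P : Measure Ω} [IsProbabilityMeasure P]
  {W : ℝ≥0 → Ω → ℝ} {N : ℝ≥0 → Ω → ℕ} {γ : ℕ → Ω → ℝ} {ν : ℝ≥0} {γbar : ℝ}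
  {κ σ y₀ T : ℝ} {μ : ℝ → ℝ} {Y : ℝ → Ω → ℝ}

/-- On an event `A` of the past up to time `s`, the mean of the demand solves a linear integral
equation: the noise only contributes the drift `γbar ν`. The last summand `0` stands for
the function `ℓ` of `variation_of_constants`. -/
theorem setIntegral_eq (hY : IsDemand P κ σ y₀ T μ W N γ Y) (h : IsDrivingNoise P W N γ ν γbar)
    (hκ : 0 < κ) (hμ : IntegrableOn μ (Icc 0 T)) {s t : ℝ} (hs : 0 ≤ s) (hst : s ≤ t) (ht : t ≤ T)
    {A : Set Ω} (hA : MeasurableSet[demandInfo Y s] A) :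
    IntervalIntegrable (fun r => ∫ ω in A, Y r ω ∂P) volume s t ∧
    ∫ ω in A, Y t ω ∂P = (∫ ω in A, Y s ω ∂P)
      + (∫ r in s..t, κ * ((μ r + γbar * ν / κ) * P.real A - ∫ ω in A, Y r ω ∂P)) + 0 := by
  have hT : 0 ≤ T := hs.trans (hst.trans ht)
  obtain ⟨Y', hY'm, hY', hY'2⟩ := hY.exists_memLp_version h hκ hT hμ
  have hsub : Ioc s t ⊆ Icc 0 T := fun r hr => ⟨hs.trans hr.1.le, hr.2.trans ht⟩
  have hμi : Integrable μ (volume.restrict (Ioc s t)) := hμ.mono_set hsub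
  have hY'i : Integrable Y' ((volume.restrict (Ioc s t)).prod (P.restrict A)) := by
    refine (hY'2.integrable one_le_two).mono_measure ?_
    exact Measure.prod_mono (Measure.restrict_mono_set _ hsub) Measure.restrict_le_self
  have hmean : ∀ r ∈ Icc 0 T, ∫ ω in A, Y' (r, ω) ∂P = ∫ ω in A, Y r ω ∂P := fun r hr =>
    integral_congr_ae (ae_restrict_of_ae (hY'.mono fun ω hω => hω r hr))
  have hmint : IntegrableOn (fun r => ∫ ω in A, Y r ω ∂P) (Ioc s t) := by
    refine (hY'i.integral_prod_left).congr ?_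
    filter_upwards [ae_restrict_mem measurableSet_Ioc] with r hr using hmean r (hsub hr)
  have hmint' : IntervalIntegrable (fun r => ∫ ω in A, Y r ω ∂P) volume s t :=
    (intervalIntegrable_iff_integrableOn_Ioc_of_le hst).2 hmint
  have hμt : IntervalIntegrable μ volume s t :=
    (intervalIntegrable_iff_integrableOn_Ioc_of_le hst).2 hμi
  refine ⟨hmint', ?_⟩
  have hYi : ∀ r ∈ Icc 0 T, Integrable (Y r) P := fun r hr =>
    (hY.memLp h hκ hμ hr).integrable one_le_two
  have hLi : ∀ r, Integrable (noise σ W N γ id r) P := fun r => by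
    obtain ⟨K, hK, hKL⟩ := h.exists_eLpNorm_noise_le σ r
    have : MemLp (noise σ W N γ id r) 2 P :=
      ⟨(h.measurable_noise σ id r).aestronglyMeasurable, (hKL r le_rfl).trans_lt hK⟩
    exact this.integrable one_le_two
  have hs' : s ∈ Icc 0 T := ⟨hs, hst.trans ht⟩
  have ht' : t ∈ Icc 0 T := ⟨hs.trans hst, ht⟩
  have hprod : Integrable (fun p : ℝ × Ω => κ * (μ p.1 - Y' p))
      ((volume.restrict (Ioc s t)).prod (P.restrict A)) :=
    ((hμi.comp_fst (P.restrict A)).sub hY'i).const_mul κ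
  have hinc : ∀ᵐ ω ∂P, Y t ω = Y s ω + (∫ r in Ioc s t, κ * (μ r - Y' (r, ω)))
      + (noise σ W N γ id t ω - noise σ W N γ id s ω) := by
    filter_upwards [hY.equation, hY.integrable_path, hY'] with ω he hi hω
    have hg : ∀ a ∈ Icc 0 T, IntervalIntegrable (fun r => κ * (μ r - Y r ω)) volume 0 a :=
      fun a ha => by
        have hsub : Icc 0 a ⊆ Icc 0 T := Icc_subset_Icc le_rfl ha.2
        exact (((intervalIntegrable_iff_integrableOn_Icc_of_le ha.1).2 (hμ.mono_set hsub)).sub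
          ((intervalIntegrable_iff_integrableOn_Icc_of_le ha.1).2 (hi.mono_set hsub))).const_mul κ
    have h1 : ∫ r in Ioc s t, κ * (μ r - Y' (r, ω))
        = (∫ r in (0 : ℝ)..t, κ * (μ r - Y r ω)) - ∫ r in (0 : ℝ)..s, κ * (μ r - Y r ω) := by
      rw [intervalIntegral.integral_interval_sub_left (hg t ht') (hg s hs'),
        intervalIntegral.integral_of_le hst]
      exact setIntegral_congr_fun measurableSet_Ioc fun r hr => by rw [hω r (hsub hr)]
    rw [h1, he t ht', he s hs', noise, noise, id, id]
    ring
  have hinner : Integrable (fun ω => ∫ r in Ioc s t, κ * (μ r - Y' (r, ω))) (P.restrict A) :=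
    hprod.integral_prod_right
  have hLA := h.setIntegral_noise_increment σ hs hst (hY.exists_pastInfo h hμ hs'.2 hA)
    (hY.exists_jumpInfo h hμ hs'.2 hA)
  have hswap : ∫ ω in A, (∫ r in Ioc s t, κ * (μ r - Y' (r, ω))) ∂P
      = ∫ r in s..t, κ * (μ r * P.real A - ∫ ω in A, Y r ω ∂P) := by
    rw [intervalIntegral.integral_of_le hst,
      ← integral_integral_swap (f := fun r ω => κ * (μ r - Y' (r, ω))) hprod]
    refine setIntegral_congr_fun measurableSet_Ioc fun r hr => ?_
    have hr' := hsub hr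
    have hYr : Integrable (fun ω => Y' (r, ω)) P :=
      (hYi r hr').congr (hY'.mono fun ω hω => (hω r hr').symm)
    rw [integral_const_mul, integral_sub (integrable_const _) hYr.integrableOn, hmean r hr',
      setIntegral_const, smul_eq_mul, mul_comm (P.real A)]
  have hsum : Integrable (fun ω => Y s ω + ∫ r in Ioc s t, κ * (μ r - Y' (r, ω)))
      (P.restrict A) := (hYi s hs').integrableOn.integrable.add hinner
  have hLint : Integrable (fun ω => noise σ W N γ id t ω - noise σ W N γ id s ω)
      (P.restrict A) := ((hLi t).sub (hLi s)).integrableOn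
  rw [integral_congr_ae (ae_restrict_of_ae hinc), integral_add hsum hLint,
    integral_add (hYi s hs').integrableOn.integrable hinner, hLA, hswap]
  have hdrift : ∀ r, κ * ((μ r + γbar * ν / κ) * P.real A - ∫ ω in A, Y r ω ∂P)
      = κ * (μ r * P.real A - ∫ ω in A, Y r ω ∂P) + γbar * ν * P.real A := by
    intro r
    field_simp
    ring
  simp_rw [hdrift]
  rw [intervalIntegral.integral_add (((hμt.mul_const _).sub hmint').const_mul κ)
    intervalIntegrable_const, intervalIntegral.integral_const, smul_eq_mul]
  ring

/-- The best forecast of the demand at time `τ` from the information at time `s`. -/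
theorem condExp_eq (hY : IsDemand P κ σ y₀ T μ W N γ Y) (h : IsDrivingNoise P W N γ ν γbar)
    (hκ : 0 < κ) (hμ : IntegrableOn μ (Icc 0 T)) {s τ : ℝ} (hs : 0 ≤ s) (hsτ : s ≤ τ)
    (hτ : τ ≤ T) :
    (fun ω => Real.exp (-κ * (τ - s)) * Y s ω
      + κ * (∫ r in s..τ, Real.exp (-κ * (τ - r)) * μ r)
      + γbar * ν / κ * (1 - Real.exp (-κ * (τ - s)))) =ᵐ[P] P[Y τ | demandInfo Y s] := by
  have hs' : s ∈ Icc 0 T := ⟨hs, hsτ.trans hτ⟩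
  have hτ' : τ ∈ Icc 0 T := ⟨hs.trans hsτ, hτ⟩
  have hYi : ∀ r ∈ Icc 0 T, Integrable (Y r) P := fun r hr =>
    (hY.memLp h hκ hμ hr).integrable one_le_two
  have hgi : Integrable (fun ω => Real.exp (-κ * (τ - s)) * Y s ω
      + κ * (∫ r in s..τ, Real.exp (-κ * (τ - r)) * μ r)
      + γbar * ν / κ * (1 - Real.exp (-κ * (τ - s)))) P :=
    (((hYi s hs').const_mul _).add (integrable_const _)).add (integrable_const _)
  refine ae_eq_condExp_of_forall_setIntegral_eq (demandInfo_le hY.measurable hs'.2) (hYi τ hτ')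
    (fun A _ _ => hgi.integrableOn) (fun A hA _ => ?_) ?_
  · have hμt : IntervalIntegrable μ volume s τ :=
      (intervalIntegrable_iff_integrableOn_Icc_of_le hsτ).2
        (hμ.mono_set (Icc_subset_Icc hs hτ))
    have hE : Continuous fun r => Real.exp (-κ * (τ - r)) := by fun_prop
    have hvoc := variation_of_constants (κ := κ) (y := fun t => ∫ ω in A, Y t ω ∂P)
      (f := fun r => (μ r + γbar * ν / κ) * P.real A) (ℓ := fun _ => 0) hsτ
      ((hμt.add intervalIntegrable_const).mul_const _)
      (hY.setIntegral_eq h hκ hμ hs hsτ hτ hA).1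
      fun t ht => (hY.setIntegral_eq h hκ hμ hs ht.1 (ht.2.trans hτ) hA).2
    have hEint : κ * ∫ r in s..τ, Real.exp (-κ * (τ - r)) = 1 - Real.exp (-κ * (τ - s)) := by
      rw [← intervalIntegral.integral_const_mul,
        intervalIntegral.integral_eq_sub_of_hasDerivAt (f := fun r => Real.exp (-κ * (τ - r)))
          (fun r _ => ?_) ((hE.intervalIntegrable _ _).const_mul κ)]
      · simp
      · have h1 : HasDerivAt (fun r => -κ * (τ - r)) κ r := by
          simpa using ((hasDerivAt_id r).const_sub τ).const_mul (-κ)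
        simpa [mul_comm] using h1.exp
    have hsplit : ∫ r in s..τ, Real.exp (-κ * (τ - r)) * ((μ r + γbar * ν / κ) * P.real A)
        = ((∫ r in s..τ, Real.exp (-κ * (τ - r)) * μ r)
          + γbar * ν / κ * ∫ r in s..τ, Real.exp (-κ * (τ - r))) * P.real A := by
      rw [← intervalIntegral.integral_const_mul, ← intervalIntegral.integral_add
        (hμt.continuousOn_mul hE.continuousOn) ((hE.intervalIntegrable _ _).const_mul _),
        ← intervalIntegral.integral_mul_const]
      congr 1
      funext r
      ring
    have hsum : Integrable (fun ω => Real.exp (-κ * (τ - s)) * Y s ω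
        + κ * (∫ r in s..τ, Real.exp (-κ * (τ - r)) * μ r)) (P.restrict A) :=
      (((hYi s hs').const_mul _).add (integrable_const _)).integrableOn
    rw [hvoc, hsplit, integral_add hsum (integrable_const _),
      integral_add ((hYi s hs').const_mul _).integrableOn.integrable (integrable_const _),
      integral_const_mul, setIntegral_const, setIntegral_const, ← hEint]
    simp only [mul_zero, intervalIntegral.integral_zero, smul_eq_mul]
    ring
  · have hYs := measurable_demandInfo Y (u := s) ⟨hs, le_rfl⟩
    exact (((hYs.const_mul _).add_const _).add_const _).aestronglyMeasurable

end IsDemand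

/-! ### The outflow of the transport equation -/

/-- The outflow of a weak solution on `(1 / lam, T)` is the delayed inflow. The test functions that
show it are constant along the characteristics, `φ(x, t) = ψ(t + (1 - x) / lam)`, with `ψ` supported
in `(1 / lam, T)`. -/
theorem IsTransportSolution.outflow_eq {lam T : ℝ} {z₀ g : ℝ → ℝ} {z : ℝ → ℝ → ℝ}
    (h : IsTransportSolution lam T z₀ g z) (hlam : 0 < lam) (hT : 1 / lam ≤ T)
    (hg : IntegrableOn g (Icc 0 T)) :
    ∀ᵐ t, t ∈ Ioo (1 / lam) T → z 1 t = g (t - 1 / lam) := by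
  have hl0 : 0 < 1 / lam := by positivity
  have hz1 : IntervalIntegrable (fun t => z 1 t) volume 0 T :=
    (intervalIntegrable_iff_integrableOn_Ioo_of_le (hl0.le.trans hT)).2 h.integrable_outflow
  have hz : IntervalIntegrable (fun t => z 1 t) volume (1 / lam) T :=
    hz1.mono_set (by
      rw [uIcc_of_le hT, uIcc_of_le (hl0.le.trans hT)]; exact Icc_subset_Icc hl0.le le_rfl)
  have hgT : IntervalIntegrable g volume 0 (T - 1 / lam) :=
    (intervalIntegrable_iff_integrableOn_Icc_of_le (by linarith)).2
      (hg.mono_set (Icc_subset_Icc le_rfl (by linarith)))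
  have hgs : IntervalIntegrable (fun t => g (t - 1 / lam)) volume (1 / lam) T := by
    have := hgT.comp_sub_right (1 / lam)
    simpa using this
  have hf := hz.sub hgs
  have key := IsOpen.ae_eq_zero_of_integral_contDiff_smul_eq_zero (μ := volume)
    (f := fun t => z 1 t - g (t - 1 / lam)) (isOpen_Ioo (a := 1 / lam) (b := T))
    (((intervalIntegrable_iff_integrableOn_Ioo_of_le hT).1 hf).locallyIntegrableOn) ?_
  · filter_upwards [key] with t ht hmem
    exact sub_eq_zero.1 (ht hmem)
  intro ψ hψ hψc hψs
  have hψ0 : ∀ t, t ∉ Ioo (1 / lam) T → ψ t = 0 := fun t ht =>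
    image_eq_zero_of_notMem_tsupport fun h => ht (hψs h)
  have hψ1 : ContDiff ℝ 1 ψ := hψ.of_le (by exact_mod_cast le_top)
  set φ : ℝ × ℝ → ℝ := fun p => ψ (p.2 + (1 - p.1) / lam) with hφ
  have hφc : ContDiff ℝ 1 φ := by
    refine hψ1.comp ?_
    fun_prop
  have hw := h.weak φ hφc (fun x hx => hψ0 _ fun hm => by
    have : 0 ≤ (1 - x) / lam := div_nonneg (by linarith [hx.2]) hlam.le
    linarith [hm.2])
  have hD : ∀ p, fderiv ℝ φ p (0, 1) + lam * fderiv ℝ φ p (1, 0) = 0 := by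
    intro p
    have h1 : HasFDerivAt (fun p : ℝ × ℝ => p.2 + (1 - p.1) * lam⁻¹)
        (ContinuousLinearMap.snd ℝ ℝ ℝ + lam⁻¹ • (-ContinuousLinearMap.fst ℝ ℝ ℝ)) p :=
      hasFDerivAt_snd.add ((hasFDerivAt_fst.const_sub 1).mul_const lam⁻¹)
    have h2 : HasFDerivAt φ (deriv ψ (p.2 + (1 - p.1) / lam) •
        (ContinuousLinearMap.snd ℝ ℝ ℝ + lam⁻¹ • (-ContinuousLinearMap.fst ℝ ℝ ℝ))) p :=
      ((hψ1.differentiable one_ne_zero _).hasDerivAt).comp_hasFDerivAt p h1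
    rw [h2.fderiv]
    simp
    field_simp
    ring
  have hx0 : ∫ x in (0 : ℝ)..1, z₀ x * φ (x, 0) = 0 := by
    rw [intervalIntegral.integral_congr (g := fun _ => 0), intervalIntegral.integral_zero]
    intro x hx
    rw [uIcc_of_le zero_le_one] at hx
    have : φ (x, 0) = 0 := hψ0 _ fun hm => by
      have h3 : (1 - x) / lam ≤ 1 / lam := by gcongr; linarith [hx.1]
      have := hm.1
      simp only [zero_add] at this
      linarith
    simp [this]
  have hlhs : ∫ t in (0 : ℝ)..T, g t * φ (0, t) = ∫ t in (1 / lam)..T, ψ t * g (t - 1 / lam) := by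
    have h1 : ∫ t in (0 : ℝ)..T, g t * φ (0, t)
        = ∫ t in (1 / lam)..(T + 1 / lam), ψ t * g (t - 1 / lam) := by
      have := intervalIntegral.integral_comp_add_right (a := 0) (b := T)
        (fun t => ψ t * g (t - 1 / lam)) (1 / lam)
      rw [zero_add] at this
      rw [← this]
      refine intervalIntegral.integral_congr fun t _ => ?_
      simp [hφ, mul_comm]
    rw [h1, intervalIntegral.integral_of_le (by linarith), intervalIntegral.integral_of_le hT]
    rw [setIntegral_eq_integral_of_forall_compl_eq_zero,
      setIntegral_eq_integral_of_forall_compl_eq_zero]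
    · intro t ht
      rw [hψ0 t fun hm => ht ⟨hm.1, hm.2.le⟩, zero_mul]
    · intro t ht
      rw [hψ0 t fun hm => ht ⟨hm.1, by linarith [hm.2]⟩, zero_mul]
  have hrhs : ∫ t in (0 : ℝ)..T, z 1 t * φ (1, t) = ∫ t in (1 / lam)..T, ψ t * z 1 t := by
    rw [intervalIntegral.integral_of_le (hl0.le.trans hT), intervalIntegral.integral_of_le hT]
    have : ∀ t, z 1 t * φ (1, t) = ψ t * z 1 t := fun t => by simp [hφ, mul_comm]
    simp_rw [this]
    rw [setIntegral_eq_integral_of_forall_compl_eq_zero,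
      setIntegral_eq_integral_of_forall_compl_eq_zero]
    · intro t ht
      rw [hψ0 t fun hm => ht ⟨hm.1, hm.2.le⟩, zero_mul]
    · intro t ht
      rw [hψ0 t fun hm => ht ⟨hl0.trans hm.1, hm.2.le⟩, zero_mul]
  simp only [hD, mul_zero, integral_zero, hx0, zero_add, hlhs, hrhs] at hw
  have hw' := mul_left_cancel₀ hlam.ne' hw
  have hsupp : ∫ t, ψ t • (z 1 t - g (t - 1 / lam))
      = ∫ t in (1 / lam)..T, ψ t * (z 1 t - g (t - 1 / lam)) := by
    rw [intervalIntegral.integral_of_le hT, setIntegral_eq_integral_of_forall_compl_eq_zero]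
    · rfl
    · intro t ht
      rw [hψ0 t fun hm => ht ⟨hm.1, hm.2.le⟩, zero_mul]
  rw [hsupp]
  simp_rw [mul_sub]
  rw [intervalIntegral.integral_sub (hz.continuousOn_mul hψ.continuous.continuousOn)
    (hgs.continuousOn_mul hψ.continuous.continuousOn), hw', sub_self]

/-- The initial and boundary data of the transport equation, carried along the characteristics: `s`
is the time at which the characteristic through `(x, s + x / lam)` starts at `x = 0`. Negative times
belong to the characteristics that start at time `0`, and inflow after time `c` is cut off. -/
noncomputable def charData (lam c : ℝ) (z₀ u : ℝ → ℝ) : ℝ → ℝ :=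
  (Ioc 0 c).indicator u + (Ioo (-(1 / lam)) 0).indicator fun s => z₀ (-lam * s)

theorem integrable_charData {lam c : ℝ} (hlam : 0 < lam) {z₀ u : ℝ → ℝ}
    (hu : IntegrableOn u (Icc 0 c)) (hz₀ : IntegrableOn z₀ (Ioo 0 1)) :
    Integrable (charData lam c z₀ u) := by
  refine ((hu.mono_set Ioc_subset_Icc_self).integrable_indicator measurableSet_Ioc).add ?_
  have h1 : Integrable ((Ioo (0 : ℝ) 1).indicator z₀) := hz₀.integrable_indicator measurableSet_Ioo
  have h2 := h1.comp_mul_left' (R := -lam) (by linarith : -lam ≠ 0)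
  refine h2.congr (Filter.Eventually.of_forall fun s => ?_)
  simp only [indicator_apply, mem_Ioo]
  have : (0 < -lam * s ∧ -lam * s < 1) ↔ (-(1 / lam) < s ∧ s < 0) := by
    have e : -(1 / lam) < s ↔ -lam * s < 1 := by
      rw [← neg_lt_neg_iff, neg_neg, lt_div_iff₀ hlam]
      constructor <;> intro h <;> linarith
    rw [e]
    constructor
    · rintro ⟨h1, h2⟩
      exact ⟨h2, by nlinarith⟩
    · rintro ⟨h1, h2⟩
      exact ⟨by nlinarith, h1⟩
  simp only [this]

theorem charData_eq_zero {lam c : ℝ} {z₀ u : ℝ → ℝ} (hc : 0 ≤ c) (hlam : 0 < lam) {s : ℝ}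
    (hs : s ∉ Ioc (-(1 / lam)) c) : charData lam c z₀ u s = 0 := by
  have hl0 : 0 < 1 / lam := by positivity
  rw [charData, Pi.add_apply, indicator_of_notMem, indicator_of_notMem, add_zero]
  · exact fun h => hs ⟨h.1, h.2.le.trans hc⟩
  · exact fun h => hs ⟨by linarith [h.1], h.2⟩

/-- The weak formulation along the characteristics. -/
theorem integral_charData_mul {lam T : ℝ} (hlam : 0 < lam) (hT : 1 / lam ≤ T)
    {G : ℝ → ℝ} (hG : Integrable G) (hG0 : ∀ s ∉ Ioc (-(1 / lam)) (T - 1 / lam), G s = 0)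
    {φ : ℝ × ℝ → ℝ} (hφ : ContDiff ℝ 1 φ) :
    IntegrableOn (fun p : ℝ × ℝ => G (p.2 - p.1 / lam)) (Ioo 0 1 ×ˢ Ioo 0 T) ∧
    ∫ p in Ioo (0 : ℝ) 1 ×ˢ Ioo 0 T,
        G (p.2 - p.1 / lam) * (fderiv ℝ φ p (0, 1) + lam * fderiv ℝ φ p (1, 0))
      = lam * ∫ s in (-(1 / lam))..(T - 1 / lam),
          G s * (φ (1, s + 1 / lam) - φ (max 0 (-lam * s), s + max 0 (-lam * s) / lam)) := by
  have hl0 : 0 < 1 / lam := by positivity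
  set D : ℝ × ℝ → ℝ := fun p => fderiv ℝ φ p (0, 1) + lam * fderiv ℝ φ p (1, 0) with hD
  have hDc : Continuous D := by
    have := hφ.continuous_fderiv one_ne_zero
    fun_prop
  set ρ : Measure ℝ := volume.restrict (Ioo 0 1) with hρ
  have hshift : MeasurePreserving (fun p : ℝ × ℝ => (p.1, p.2 + p.1 / lam)) (ρ.prod volume)
      (ρ.prod volume) :=
    (MeasurePreserving.id ρ).skew_product (g := fun x t => t + x / lam)
      (by fun_prop) (Filter.Eventually.of_forall fun x =>
        (measurePreserving_add_right volume (x / lam)).map_eq)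
  have hshift' : MeasurePreserving (fun p : ℝ × ℝ => (p.1, p.2 - p.1 / lam)) (ρ.prod volume)
      (ρ.prod volume) :=
    (MeasurePreserving.id ρ).skew_product (g := fun x t => t - x / lam)
      (by fun_prop) (Filter.Eventually.of_forall fun x =>
        (measurePreserving_sub_right volume (x / lam)).map_eq)
  have hGi : Integrable (fun p : ℝ × ℝ => G (p.2 - p.1 / lam)) (ρ.prod volume) :=
    hshift'.integrable_comp_of_integrable (hG.comp_snd ρ)
  have hset : (volume : Measure (ℝ × ℝ)).restrict (Ioo (0 : ℝ) 1 ×ˢ Ioo 0 T)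
      = (ρ.prod volume).restrict (univ ×ˢ Ioo 0 T) := by
    rw [Measure.volume_eq_prod, ← Measure.prod_restrict, ← Measure.prod_restrict,
      Measure.restrict_univ]
  have hms : MeasurableSet ((univ : Set ℝ) ×ˢ Ioo (0 : ℝ) T) :=
    MeasurableSet.univ.prod measurableSet_Ioo
  refine ⟨by rw [IntegrableOn, hset]; exact hGi.integrableOn, ?_⟩
  rw [hset, ← integral_indicator hms]
  set H : ℝ × ℝ → ℝ := ((univ : Set ℝ) ×ˢ Ioo (0 : ℝ) T).indicator
    fun p => G (p.2 - p.1 / lam) * D p with hH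
  have hHi : Integrable H (ρ.prod volume) := by
    rw [hH, integrable_indicator_iff hms, IntegrableOn, ← hset]
    obtain ⟨C, hC⟩ := ((isCompact_Icc (a := (0 : ℝ)) (b := 1)).prod
      (isCompact_Icc (a := (0 : ℝ)) (b := T))).exists_bound_of_continuousOn hDc.continuousOn
    refine Integrable.mul_bdd (c := C) ?_ hDc.aestronglyMeasurable ?_
    · rw [hset]; exact hGi.integrableOn
    · filter_upwards [ae_restrict_mem (measurableSet_Ioo.prod measurableSet_Ioo)] with p hp
      exact hC p ⟨Ioo_subset_Icc_self hp.1, Ioo_subset_Icc_self hp.2⟩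
  rw [integral_prod _ hHi]
  have htrans : ∀ x, ∫ t, H (x, t) = ∫ s, H (x, s + x / lam) := fun x =>
    (integral_add_right_eq_self (fun t => H (x, t)) (x / lam)).symm
  simp_rw [htrans]
  rw [integral_integral_swap (f := fun x s => H (x, s + x / lam))
    (hshift.integrable_comp_of_integrable hHi), ← intervalIntegral.integral_const_mul,
    intervalIntegral.integral_of_le (by linarith),
    ← setIntegral_eq_integral_of_forall_compl_eq_zero (s := Ioc (-(1 / lam)) (T - 1 / lam))]
  swap
  · intro s hs
    simp only [hH, indicator_apply, add_sub_cancel_right, hG0 s hs, zero_mul, ite_self,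
      integral_zero]
  refine setIntegral_congr_fun measurableSet_Ioc fun s hs => ?_
  -- the integral over the part of the characteristic inside the strip
  set a := max 0 (-lam * s) with ha
  have hls : -lam * s < 1 := by
    have := mul_lt_mul_of_pos_left hs.1 hlam
    rw [mul_neg, mul_one_div_cancel hlam.ne'] at this
    linarith
  have ha1 : a ≤ 1 := max_le zero_le_one hls.le
  have hmem : ∀ x ∈ Ioo (0 : ℝ) 1, (s + x / lam ∈ Ioo 0 T ↔ x ∈ Ioc a 1) := by
    intro x hx
    have h1 : 0 < s + x / lam ↔ -lam * s < x := by
      rw [← mul_lt_mul_iff_of_pos_left hlam, mul_add, mul_zero, mul_div_cancel₀ _ hlam.ne']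
      constructor <;> intro h <;> linarith
    have h2 : s + x / lam < T := by
      have : x / lam < 1 / lam := by gcongr; exact hx.2
      linarith [hs.2]
    simp only [mem_Ioo, mem_Ioc, h1, h2, and_true, ha, max_lt_iff, hx.1, hx.2.le, true_and]
  have hinner : ∫ x, H (x, s + x / lam) ∂ρ = ∫ x in a..1, G s * D (x, s + x / lam) := by
    rw [intervalIntegral.integral_of_le ha1, hρ, ← integral_indicator measurableSet_Ioo,
      ← integral_indicator measurableSet_Ioc]
    refine integral_congr_ae ?_
    have hne : ∀ᵐ x : ℝ, x ≠ 1 := by simp [ae_iff, measure_singleton]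
    filter_upwards [hne] with x hx1
    by_cases hx : x ∈ Ioo (0 : ℝ) 1
    · rw [indicator_of_mem hx]
      simp only [hH, indicator_apply, mem_prod, mem_univ, true_and, hmem x hx,
        add_sub_cancel_right]
    · rw [indicator_of_notMem hx, indicator_of_notMem]
      exact fun hm => hx ⟨(le_max_left _ _).trans_lt hm.1, lt_of_le_of_ne hm.2 hx1⟩
  have hderiv : ∀ x : ℝ, HasDerivAt (fun x => lam * φ (x, s + x / lam)) (D (x, s + x / lam)) x := by
    intro x
    have h1 : HasDerivAt (fun x : ℝ => (x, s + x / lam)) ((1 : ℝ), 1 / lam) x :=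
      (hasDerivAt_id x).prodMk (((hasDerivAt_id x).div_const lam).const_add s)
    have h2 := ((hφ.differentiable one_ne_zero (x, s + x / lam)).hasFDerivAt).comp_hasDerivAt x h1
    have h3 : ((1 : ℝ), 1 / lam) = (1, 0) + (1 / lam) • (0, 1) := by simp
    rw [h3, map_add, map_smul] at h2
    refine (h2.const_mul lam).congr_deriv ?_
    simp only [hD, smul_eq_mul]
    field_simp
    ring
  rw [hinner, intervalIntegral.integral_const_mul,
    intervalIntegral.integral_eq_sub_of_hasDerivAt (fun x _ => hderiv x)
      (Continuous.intervalIntegrable (by fun_prop) _ _)]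
  ring

/-- The method of characteristics gives a weak solution. -/
theorem isTransportSolution_charData {lam T : ℝ} (hlam : 0 < lam) (hT : 1 / lam ≤ T)
    {z₀ u : ℝ → ℝ} (hz₀ : IntegrableOn z₀ (Ioo 0 1)) (hu : IntegrableOn u (Icc 0 (T - 1 / lam))) :
    IsTransportSolution lam T z₀ ((Icc 0 (T - 1 / lam)).indicator u)
      fun x t => charData lam (T - 1 / lam) z₀ u (t - x / lam) := by
  have hl0 : 0 < 1 / lam := by positivity
  have hc : 0 ≤ T - 1 / lam := by linarith
  have hG := integrable_charData hlam hu hz₀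
  have hG0 : ∀ s ∉ Ioc (-(1 / lam)) (T - 1 / lam), charData lam (T - 1 / lam) z₀ u s = 0 :=
    fun s hs => charData_eq_zero hc hlam hs
  refine ⟨(integral_charData_mul hlam hT hG hG0 (φ := fun _ => 0) contDiff_const).1,
    (hG.comp_sub_right (1 / lam)).integrableOn, fun φ hφ _ => ?_⟩
  rw [(integral_charData_mul hlam hT hG hG0 hφ).2]
  set G := charData lam (T - 1 / lam) z₀ u with hGdef
  have hφc := hφ.continuous
  have hend : ∫ t in (0 : ℝ)..T, G (t - 1 / lam) * φ (1, t)
      = ∫ s in (-(1 / lam))..(T - 1 / lam), G s * φ (1, s + 1 / lam) := by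
    have := intervalIntegral.integral_comp_sub_right (a := 0) (b := T)
      (fun s => G s * φ (1, s + 1 / lam)) (1 / lam)
    simpa using this
  have hGint : ∀ a b, IntervalIntegrable G volume a b := fun a b => hG.intervalIntegrable
  have hcs : Continuous fun s : ℝ => φ (max 0 (-lam * s), s + max 0 (-lam * s) / lam) := by fun_prop
  have hce : Continuous fun s : ℝ => φ (1, s + 1 / lam) := by fun_prop
  have hstart : ∀ a b, IntervalIntegrable
      (fun s => G s * φ (max 0 (-lam * s), s + max 0 (-lam * s) / lam)) volume a b :=
    fun a b => (hGint a b).mul_continuousOn hcs.continuousOn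
  -- characteristics that start on the initial line
  have hneg : lam * ∫ s in (-(1 / lam))..0,
      G s * φ (max 0 (-lam * s), s + max 0 (-lam * s) / lam)
      = ∫ x in (0 : ℝ)..1, z₀ x * φ (x, 0) := by
    have h1 : ∫ s in (-(1 / lam))..0,
        G s * φ (max 0 (-lam * s), s + max 0 (-lam * s) / lam)
        = ∫ s in (-(1 / lam))..0, z₀ (-lam * s) * φ (-lam * s, 0) := by
      rw [intervalIntegral.integral_of_le (by linarith),
        intervalIntegral.integral_of_le (by linarith),
        integral_Ioc_eq_integral_Ioo, integral_Ioc_eq_integral_Ioo]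
      refine setIntegral_congr_fun measurableSet_Ioo fun s hs => ?_
      have h2 : G s = z₀ (-lam * s) := by
        rw [hGdef, charData, Pi.add_apply, indicator_of_mem hs, indicator_of_notMem, zero_add]
        exact fun h => absurd h.1 (not_lt.2 hs.2.le)
      have h3 : max 0 (-lam * s) = -lam * s := max_eq_right (by nlinarith [hs.2])
      have h4 : s + -lam * s / lam = 0 := by field_simp; ring
      simp only [h2, h3, h4]
    rw [h1, intervalIntegral.integral_comp_mul_left (fun x => z₀ x * φ (x, 0))
      (by linarith : -lam ≠ 0), intervalIntegral.integral_symm]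
    have h5 : -lam * -(1 / lam) = 1 := by field_simp
    rw [h5, mul_zero, smul_eq_mul]
    field_simp
  -- characteristics that start at the inflow boundary
  have hpos : ∫ s in (0 : ℝ)..(T - 1 / lam),
      G s * φ (max 0 (-lam * s), s + max 0 (-lam * s) / lam)
      = ∫ t in (0 : ℝ)..T, (Icc 0 (T - 1 / lam)).indicator u t * φ (0, t) := by
    rw [intervalIntegral.integral_of_le hc, intervalIntegral.integral_of_le (hl0.le.trans hT),
      ← integral_indicator measurableSet_Ioc, ← integral_indicator measurableSet_Ioc]
    refine integral_congr_ae (Filter.Eventually.of_forall fun s => ?_)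
    by_cases hs : s ∈ Ioc 0 (T - 1 / lam)
    · have h2 : G s = u s := by
        rw [hGdef, charData, Pi.add_apply, indicator_of_mem hs, indicator_of_notMem, add_zero]
        exact fun h => absurd h.2 (not_lt.2 hs.1.le)
      have h3 : max 0 (-lam * s) = 0 := max_eq_left (by nlinarith [hs.1])
      rw [indicator_of_mem hs, indicator_of_mem (show s ∈ Ioc 0 T from ⟨hs.1, by linarith [hs.2]⟩),
        indicator_of_mem (Ioc_subset_Icc_self hs), h2, h3, zero_div, add_zero]
    · rw [indicator_of_notMem hs]
      by_cases hs0 : s ∈ Ioc 0 T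
      · rw [indicator_of_mem hs0, indicator_of_notMem, zero_mul]
        exact fun h => hs ⟨hs0.1, h.2⟩
      · rw [indicator_of_notMem hs0]
  simp_rw [mul_sub]
  rw [intervalIntegral.integral_sub ((hGint _ _).mul_continuousOn hce.continuousOn) (hstart _ _),
    hend, ← intervalIntegral.integral_add_adjacent_intervals (hstart (-(1 / lam)) 0)
      (hstart 0 (T - 1 / lam)), hpos, ← hneg]
  ring

/-! ### Controls, states and the objective -/

section

variable {Ω : Type*} [MeasurableSpace Ω] {P : Measure Ω} [IsProbabilityMeasure P]
  {lam T : ℝ} {z₀ : ℝ → ℝ} {Y u : ℝ → Ω → ℝ}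

theorem measurePreserving_add_delay (lam T : ℝ) :
    MeasurePreserving (fun t : ℝ => t + 1 / lam) (volume.restrict (Icc 0 (T - 1 / lam)))
      (volume.restrict (Icc (1 / lam) T)) := by
  have := (measurePreserving_add_right (volume : Measure ℝ) (1 / lam)).restrict_preimage
    (measurableSet_Icc (a := 1 / lam) (b := T))
  simpa using this

theorem measurePreserving_sub_delay (lam T : ℝ) :
    MeasurePreserving (fun t : ℝ => t - 1 / lam) (volume.restrict (Icc (1 / lam) T))
      (volume.restrict (Icc 0 (T - 1 / lam))) := by
  have := (measurePreserving_sub_right (volume : Measure ℝ) (1 / lam)).restrict_preimage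
    (measurableSet_Icc (a := 0) (b := T - 1 / lam))
  simpa using this

theorem ae_integrableOn_control
    (hu : MemLp (fun p : ℝ × Ω => u p.1 p.2) 2 ((volume.restrict (Icc 0 (T - 1 / lam))).prod P)) :
    ∀ᵐ ω ∂P, IntegrableOn (fun t => u t ω) (Icc 0 (T - 1 / lam)) :=
  (hu.integrable one_le_two).prod_left_ae

/-- The outflow of a state is the control, delayed by the transport time. -/
theorem IsState.outflow_eq {z : Ω → ℝ → ℝ → ℝ} (hz : IsState P lam T z₀ u z) (hlam : 0 < lam)
    (hT : 1 / lam ≤ T)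
    (hu : MemLp (fun p : ℝ × Ω => u p.1 p.2) 2 ((volume.restrict (Icc 0 (T - 1 / lam))).prod P)) :
    ∀ᵐ p ∂((volume.restrict (Icc 0 (T - 1 / lam))).prod P),
      z p.2 1 (p.1 + 1 / lam) = u p.1 p.2 := by
  have hl0 : 0 < 1 / lam := by positivity
  have hzm : AEStronglyMeasurable (fun p : ℝ × Ω => z p.2 1 (p.1 + 1 / lam))
      ((volume.restrict (Icc 0 (T - 1 / lam))).prod P) :=
    hz.outflow.comp_measurePreserving
      ((measurePreserving_add_delay lam T).prod (MeasurePreserving.id P))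
  have hpath : ∀ᵐ ω ∂P, ∀ᵐ t ∂(volume.restrict (Icc 0 (T - 1 / lam))),
      z ω 1 (t + 1 / lam) = u t ω := by
    filter_upwards [hz.transport, ae_integrableOn_control hu] with ω hω hi
    have h1 := hω.outflow_eq hlam hT (hi.integrable_indicator measurableSet_Icc).integrableOn
    have h2 := ae_restrict_of_ae (s := Icc (1 / lam) T) h1
    have h3 := (measurePreserving_add_delay lam T).quasiMeasurePreserving.ae h2
    have hne : ∀ᵐ t : ℝ, t ≠ 0 ∧ t ≠ T - 1 / lam := by
      have h4 : ∀ᵐ t : ℝ, t ≠ 0 := by simp [ae_iff, measure_singleton]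
      have h5 : ∀ᵐ t : ℝ, t ≠ T - 1 / lam := by simp [ae_iff, measure_singleton]
      exact h4.and h5
    filter_upwards [h3, ae_restrict_mem measurableSet_Icc, ae_restrict_of_ae hne] with t ht hm hn
    have hmem : t + 1 / lam ∈ Ioo (1 / lam) T :=
      ⟨by linarith [lt_of_le_of_ne hm.1 hn.1.symm], by linarith [lt_of_le_of_ne hm.2 hn.2]⟩
    rw [ht hmem, add_sub_cancel_right, indicator_of_mem hm]
  have hd : AEMeasurable (fun p : ℝ × Ω => ‖z p.2 1 (p.1 + 1 / lam) - u p.1 p.2‖ₑ)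
      ((volume.restrict (Icc 0 (T - 1 / lam))).prod P) := (hzm.sub hu.1).enorm
  have hzero : ∫⁻ p, ‖z p.2 1 (p.1 + 1 / lam) - u p.1 p.2‖ₑ
      ∂((volume.restrict (Icc 0 (T - 1 / lam))).prod P) = 0 := by
    rw [lintegral_prod_symm _ hd, lintegral_eq_zero_of_ae_eq_zero]
    filter_upwards [hpath] with ω hω
    refine lintegral_eq_zero_of_ae_eq_zero ?_
    filter_upwards [hω] with t ht
    simp only [ht, sub_self, enorm_zero, Pi.zero_apply]
  filter_upwards [(lintegral_eq_zero_iff' hd).1 hzero] with p hp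
  simpa [sub_eq_zero] using hp

theorem objective_eq {z : Ω → ℝ → ℝ → ℝ} (hz : IsState P lam T z₀ u z) (hlam : 0 < lam)
    (hT : 1 / lam ≤ T)
    (hu : MemLp (fun p : ℝ × Ω => u p.1 p.2) 2 ((volume.restrict (Icc 0 (T - 1 / lam))).prod P)) :
    objective P lam T Y z = ∫⁻ t in Icc 0 (T - 1 / lam),
      ∫⁻ ω, ENNReal.ofReal ((Y (t + 1 / lam) ω - u t ω) ^ 2) ∂P := by
  rw [objective, ← (measurePreserving_add_delay lam T).lintegral_comp_emb
    (measurableEmbedding_addRight (1 / lam))]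
  refine lintegral_congr_ae ?_
  filter_upwards [Measure.ae_ae_of_ae_prod (hz.outflow_eq hlam hT hu)] with t ht
  refine lintegral_congr_ae ?_
  filter_upwards [ht] with ω hω
  simp only [hω]

theorem exists_isState (hlam : 0 < lam) (hT : 1 / lam ≤ T) (hz₀ : IntegrableOn z₀ (Ioo 0 1))
    (hu : MemLp (fun p : ℝ × Ω => u p.1 p.2) 2 ((volume.restrict (Icc 0 (T - 1 / lam))).prod P)) :
    ∃ z, IsState P lam T z₀ u z := by
  have hl0 : 0 < 1 / lam := by positivity
  refine ⟨fun ω x t => charData lam (T - 1 / lam) z₀ (fun t => u t ω) (t - x / lam), ?_, ?_⟩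
  · filter_upwards [ae_integrableOn_control hu] with ω hω
    exact isTransportSolution_charData hlam hT hz₀ hω
  · refine (hu.1.comp_measurePreserving
      ((measurePreserving_sub_delay lam T).prod (MeasurePreserving.id P))).congr ?_
    have hne : ∀ᵐ t : ℝ ∂(volume.restrict (Icc (1 / lam) T)), t ≠ 1 / lam :=
      ae_restrict_of_ae (by simp [ae_iff, measure_singleton])
    filter_upwards [Measure.quasiMeasurePreserving_fst.ae hne,
      Measure.quasiMeasurePreserving_fst.ae (ae_restrict_mem measurableSet_Icc)] with p hp hm
    have h1 : 1 / lam < p.1 := lt_of_le_of_ne hm.1 hp.symm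
    have h2 : p.1 - 1 / lam ∈ Ioc 0 (T - 1 / lam) := ⟨by linarith, by linarith [hm.2]⟩
    simp only [Function.comp, Prod.map, id, charData, Pi.add_apply, indicator_of_mem h2]
    rw [indicator_of_notMem, add_zero]
    exact fun h => absurd h.2 (not_lt.2 h2.1.le)

/-! ### Optimality of the conditional expectation -/

/-- Pythagoras: the mean square error of a `G`-measurable estimate exceeds that of the conditional
expectation by the squared `L²` distance of the two. -/
theorem lintegral_sub_sq_eq_add {Ω : Type*} {G mΩ : MeasurableSpace Ω} {P : Measure Ω}
    [IsProbabilityMeasure P] (hG : G ≤ mΩ) {X w v : Ω → ℝ} (hX : MemLp X 2 P)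
    (hw : MemLp w 2 P) (hv : MemLp v 2 P)
    (hwG : Measurable[G] w) (hvG : Measurable[G] v) (hwX : w =ᵐ[P] P[X | G]) :
    ∫⁻ ω, ENNReal.ofReal ((X ω - v ω) ^ 2) ∂P
      = (∫⁻ ω, ENNReal.ofReal ((X ω - w ω) ^ 2) ∂P)
        + ∫⁻ ω, ENNReal.ofReal ((w ω - v ω) ^ 2) ∂P := by
  have hd : MemLp (w - v) 2 P := hw.sub hv
  have he : MemLp (X - w) 2 P := hX.sub hw
  have hprod : Integrable ((w - v) * (X - w)) P := hd.integrable_mul he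
  have horth : ∫ ω, ((w - v) * (X - w)) ω ∂P = 0 := by
    rw [← integral_condExp hG]
    have h1 := condExp_mul_of_stronglyMeasurable_left (μ := P) (m := G)
      (hwG.sub hvG).stronglyMeasurable hprod (he.integrable one_le_two)
    have h2 := condExp_sub (hX.integrable one_le_two) (hw.integrable one_le_two) G
    have h3 := condExp_of_stronglyMeasurable hG hwG.stronglyMeasurable (hw.integrable one_le_two)
    rw [integral_congr_ae h1]
    refine integral_eq_zero_of_ae ?_
    filter_upwards [h2, hwX] with ω h4 h5
    simp only [Pi.mul_apply, h4, h3, Pi.sub_apply, Pi.zero_apply]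
    rw [h5]
    ring
  have hsq : ∀ f : Ω → ℝ, MemLp f 2 P →
      ∫⁻ ω, ENNReal.ofReal (f ω ^ 2) ∂P = ENNReal.ofReal (∫ ω, f ω ^ 2 ∂P) := fun f hf =>
    (ofReal_integral_eq_lintegral_ofReal hf.integrable_sq
      (Filter.Eventually.of_forall fun _ => sq_nonneg _)).symm
  have hei : Integrable (fun ω => (X ω - w ω) ^ 2) P := he.integrable_sq
  have hdi : Integrable (fun ω => (w ω - v ω) ^ 2) P := hd.integrable_sq
  have h1 := hsq _ (hX.sub hv)
  have h2 := hsq _ he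
  have h3 := hsq _ hd
  simp only [Pi.sub_apply] at h1 h2 h3
  rw [h1, h2, h3, ← ENNReal.ofReal_add (integral_nonneg fun _ => sq_nonneg _)
    (integral_nonneg fun _ => sq_nonneg _), ← integral_add hei hdi]
  congr 1
  have h4 : ∀ ω, (X ω - v ω) ^ 2 = ((X ω - w ω) ^ 2 + (w ω - v ω) ^ 2)
      + 2 * ((w - v) * (X - w)) ω := by
    intro ω
    simp only [Pi.mul_apply, Pi.sub_apply]
    ring
  simp_rw [h4]
  have hsum : Integrable (fun ω => (X ω - w ω) ^ 2 + (w ω - v ω) ^ 2) P := hei.add hdi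
  rw [integral_add hsum (hprod.const_mul 2), integral_const_mul, horth, mul_zero, add_zero]

/-- An admissible control that forecasts the demand at the time of the outflow is the optimal
control. -/
theorem isTheOptimalControl_of_condExp (hlam : 0 < lam) (hT : 1 / lam ≤ T)
    (hz₀ : IntegrableOn z₀ (Ioo 0 1)) {G : ℝ → MeasurableSpace Ω}
    (hG : ∀ t ∈ Icc 0 (T - 1 / lam), G t ≤ ‹MeasurableSpace Ω›)
    (hY : ∀ t ∈ Icc 0 (T - 1 / lam), MemLp (Y (t + 1 / lam)) 2 P) {K : ℝ≥0∞} (hK : K < ∞)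
    (hYK : ∀ t ∈ Icc 0 (T - 1 / lam), eLpNorm (Y (t + 1 / lam)) 2 P ≤ K)
    (hu : IsAdmissible P lam T G u)
    (huY : ∀ t ∈ Icc 0 (T - 1 / lam), u t =ᵐ[P] P[Y (t + 1 / lam) | G t]) :
    IsTheOptimalControl P lam T z₀ Y G u := by
  have huL : ∀ t ∈ Icc 0 (T - 1 / lam), MemLp (u t) 2 P := fun t ht =>
    ((hY t ht).condExp one_le_two).ae_eq (huY t ht).symm
  -- the error of the forecast, and the additional error of another control
  set e : ℝ → ℝ≥0∞ := fun t => ∫⁻ ω, ENNReal.ofReal ((Y (t + 1 / lam) ω - u t ω) ^ 2) ∂P with he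
  have hpyth : ∀ v, IsAdmissible P lam T G v →
      ∫⁻ t in Icc 0 (T - 1 / lam), ∫⁻ ω, ENNReal.ofReal ((Y (t + 1 / lam) ω - v t ω) ^ 2) ∂P
      = (∫⁻ t in Icc 0 (T - 1 / lam), e t)
        + ∫⁻ p, ENNReal.ofReal ((u p.1 p.2 - v p.1 p.2) ^ 2)
            ∂((volume.restrict (Icc 0 (T - 1 / lam))).prod P) := by
    intro v hv
    have hm : AEMeasurable (fun p : ℝ × Ω => ENNReal.ofReal ((u p.1 p.2 - v p.1 p.2) ^ 2))
        ((volume.restrict (Icc 0 (T - 1 / lam))).prod P) :=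
      ((hu.memLp.1.sub hv.memLp.1).aemeasurable.pow_const 2).ennreal_ofReal
    rw [lintegral_prod _ hm, ← lintegral_add_right' _ hm.lintegral_prod_right']
    refine lintegral_congr_ae ?_
    have hvm : ∀ᵐ t ∂(volume.restrict (Icc 0 (T - 1 / lam))),
        Integrable (fun ω => v t ω ^ 2) P := hv.memLp.integrable_sq.prod_right_ae
    filter_upwards [ae_restrict_mem measurableSet_Icc, hvm] with t ht hvt
    have hvt' : MemLp (v t) 2 P := (memLp_two_iff_integrable_sq
      ((hv.measurable t ht).mono (hG t ht) le_rfl).aestronglyMeasurable).2 hvt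
    exact lintegral_sub_sq_eq_add (hG t ht) (hY t ht) (huL t ht) hvt' (hu.measurable t ht)
      (hv.measurable t ht) (huY t ht)
  have hfin : ∫⁻ t in Icc 0 (T - 1 / lam), e t < ∞ := by
    have hb : ∀ t ∈ Icc 0 (T - 1 / lam), e t ≤ K ^ (2 : ℝ) := by
      intro t ht
      have h1 := lintegral_sub_sq_eq_add (hG t ht) (hY t ht) (huL t ht) (MemLp.zero (ε := ℝ))
        (hu.measurable t ht) measurable_const (huY t ht)
      refine (le_self_add.trans h1.ge).trans ?_
      have h2 := ENNReal.rpow_le_rpow (hYK t ht) (zero_le_two (α := ℝ))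
      rw [eLpNorm_eq_lintegral_rpow_enorm_toReal (by norm_num) (by norm_num), ← ENNReal.rpow_mul,
        ENNReal.toReal_ofNat, one_div_mul_cancel two_ne_zero, ENNReal.rpow_one] at h2
      refine le_trans (le_of_eq ?_) h2
      congr 1
      funext ω
      rw [ENNReal.rpow_ofNat, ← ofReal_norm, ← ENNReal.ofReal_pow (norm_nonneg _),
        Real.norm_eq_abs, sq_abs]
      simp
    refine (setLIntegral_mono' measurableSet_Icc hb).trans_lt ?_
    rw [lintegral_const]
    exact ENNReal.mul_lt_top (ENNReal.rpow_lt_top_of_nonneg zero_le_two hK.ne)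
      (measure_lt_top _ _)
  refine ⟨⟨hu, exists_isState hlam hT hz₀ hu.memLp, fun z hz v hv z' hz' => ?_⟩, fun v hv => ?_⟩
  · rw [objective_eq hz hlam hT hu.memLp, objective_eq hz' hlam hT hv.memLp, hpyth v hv]
    exact le_self_add
  · obtain ⟨hva, ⟨z', hz'⟩, hmin⟩ := hv
    obtain ⟨z, hz⟩ := exists_isState hlam hT hz₀ hu.memLp
    have h1 := hmin z' hz' u hu z hz
    rw [objective_eq hz hlam hT hu.memLp, objective_eq hz' hlam hT hva.memLp, hpyth v hva] at h1
    have h2 := nonpos_iff_eq_zero.1 (ENNReal.le_of_add_le_add_left hfin.ne (h1.trans_eq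
      (add_zero _).symm))
    have hm : AEMeasurable (fun p : ℝ × Ω => ENNReal.ofReal ((u p.1 p.2 - v p.1 p.2) ^ 2))
        ((volume.restrict (Icc 0 (T - 1 / lam))).prod P) :=
      ((hu.memLp.1.sub hva.memLp.1).aemeasurable.pow_const 2).ennreal_ofReal
    filter_upwards [(lintegral_eq_zero_iff' hm).1 h2] with p hp
    have h3 : (u p.1 p.2 - v p.1 p.2) ^ 2 ≤ 0 := ENNReal.ofReal_eq_zero.1 hp
    have h4 := pow_eq_zero_iff two_ne_zero |>.1 (le_antisymm h3 (sq_nonneg _))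
    linarith

/-! ### Forecasts at the last update -/

/-- The contribution of `μ` to the forecast is measurable in time: it is a difference of values of a
continuous primitive. -/
theorem exists_measurable_drift (κ lam : ℝ) (hlam : 0 < lam) {μ : ℝ → ℝ}
    (hμ : IntegrableOn μ (Icc 0 T)) {θ : ℝ → ℝ} (hθm : Measurable θ)
    (hθ : ∀ t ∈ Icc 0 (T - 1 / lam), θ t ∈ Icc 0 t) :
    ∃ D : ℝ → ℝ, Measurable D ∧ ∀ t ∈ Icc 0 (T - 1 / lam),
      ∫ r in (θ t)..(t + 1 / lam), Real.exp (-κ * (t + 1 / lam - r)) * μ r = D t := by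
  have hl0 : 0 < 1 / lam := by positivity
  have hm : Integrable ((Icc 0 T).indicator fun r => Real.exp (κ * r) * μ r) :=
    (hμ.continuousOn_mul (by fun_prop) isCompact_Icc).integrable_indicator measurableSet_Icc
  have hint : ∀ a b, IntervalIntegrable ((Icc 0 T).indicator fun r => Real.exp (κ * r) * μ r)
      volume a b := fun a b => hm.intervalIntegrable
  set M : ℝ → ℝ := fun x => ∫ r in (0 : ℝ)..x,
    (Icc 0 T).indicator (fun r => Real.exp (κ * r) * μ r) r with hM
  have hMc : Continuous M := intervalIntegral.continuous_primitive hint 0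
  refine ⟨fun t => Real.exp (-κ * (t + 1 / lam)) * (M (t + 1 / lam) - M (θ t)), ?_, ?_⟩
  · have h1 : Measurable fun t => M (θ t) := hMc.measurable.comp hθm
    have h2 : Continuous fun t => M (t + 1 / lam) := hMc.comp (by fun_prop)
    exact Measurable.mul (by fun_prop) (h2.measurable.sub h1)
  · intro t ht
    have hle : θ t ≤ t + 1 / lam := by linarith [(hθ t ht).2]
    simp only [hM]
    rw [intervalIntegral.integral_interval_sub_left (hint _ _) (hint _ _),
      ← intervalIntegral.integral_const_mul]
    refine intervalIntegral.integral_congr fun r hr => ?_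
    rw [uIcc_of_le hle] at hr
    have hr' : r ∈ Icc 0 T := ⟨(hθ t ht).1.trans hr.1, by linarith [hr.2, ht.2]⟩
    simp only [indicator_of_mem hr']
    rw [← mul_assoc, ← Real.exp_add]
    ring_nf

variable {W : ℝ≥0 → Ω → ℝ} {N : ℝ≥0 → Ω → ℕ} {γ : ℕ → Ω → ℝ} {ν : ℝ≥0} {γbar : ℝ}
  {κ σ y₀ : ℝ} {μ : ℝ → ℝ}

/-- If at time `t` the demand is known up to the time `θ t ≤ t`, the forecast of the demand at time
`t + 1 / lam` is the optimal control. -/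
theorem IsDemand.isTheOptimalControl_forecast (hY : IsDemand P κ σ y₀ T μ W N γ Y)
    (h : IsDrivingNoise P W N γ ν γbar) (hκ : 0 < κ) (hlam : 0 < lam) (hT : 1 / lam ≤ T)
    (hμ : IntegrableOn μ (Icc 0 T)) (hz₀ : IntegrableOn z₀ (Ioo 0 1)) {θ : ℝ → ℝ}
    (hθm : Measurable θ) (hθ : ∀ t ∈ Icc 0 (T - 1 / lam), θ t ∈ Icc 0 t)
    (hu : ∀ t ∈ Icc 0 (T - 1 / lam), Measurable[demandInfo Y (θ t)] (u t))
    (huY : ∀ᵐ ω ∂P, ∀ t ∈ Icc 0 (T - 1 / lam), u t ω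
      = Real.exp (-κ * (t + 1 / lam - θ t)) * Y (θ t) ω
        + κ * (∫ r in (θ t)..(t + 1 / lam), Real.exp (-κ * (t + 1 / lam - r)) * μ r)
        + γbar * ν / κ * (1 - Real.exp (-κ * (t + 1 / lam - θ t)))) :
    IsTheOptimalControl P lam T z₀ Y (fun t => demandInfo Y (θ t)) u ∧
      ∀ t ∈ Icc 0 (T - 1 / lam), u t =ᵐ[P] P[Y (t + 1 / lam) | demandInfo Y (θ t)] := by
  have hl0 : 0 < 1 / lam := by positivity
  have hT0 : 0 ≤ T := hl0.le.trans hT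
  have hτ : ∀ t ∈ Icc 0 (T - 1 / lam), t + 1 / lam ∈ Icc 0 T := fun t ht =>
    ⟨by linarith [ht.1], by linarith [ht.2]⟩
  have hθT : ∀ t ∈ Icc 0 (T - 1 / lam), θ t ∈ Icc 0 T := fun t ht =>
    ⟨(hθ t ht).1, by linarith [(hθ t ht).2, ht.2]⟩
  have hcond : ∀ t ∈ Icc 0 (T - 1 / lam),
      u t =ᵐ[P] P[Y (t + 1 / lam) | demandInfo Y (θ t)] := by
    intro t ht
    have h1 := hY.condExp_eq h hκ hμ (hθ t ht).1 (by linarith [(hθ t ht).2] : θ t ≤ t + 1 / lam)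
      (hτ t ht).2
    filter_upwards [h1, huY] with ω h2 h3
    rw [← h2, h3 t ht]
  obtain ⟨K, hK, hKY⟩ := hY.exists_eLpNorm_le h hκ hμ
  obtain ⟨Y', hY'm, hY'⟩ := hY.exists_version h hT0 hμ
  obtain ⟨D, hDm, hD⟩ := exists_measurable_drift (T := T) κ lam hlam hμ hθm hθ
  have hum : AEStronglyMeasurable (fun p : ℝ × Ω => u p.1 p.2)
      ((volume.restrict (Icc 0 (T - 1 / lam))).prod P) := by
    have hYθ : Measurable fun p : ℝ × Ω => Y' (θ p.1, p.2) :=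
      hY'm.measurable.comp ((hθm.comp measurable_fst).prodMk measurable_snd)
    have hform : Measurable fun p : ℝ × Ω =>
        Real.exp (-κ * (p.1 + 1 / lam - θ p.1)) * Y' (θ p.1, p.2) + κ * D p.1
          + γbar * ν / κ * (1 - Real.exp (-κ * (p.1 + 1 / lam - θ p.1))) := by fun_prop
    refine hform.aestronglyMeasurable.congr ?_
    filter_upwards [Measure.quasiMeasurePreserving_fst.ae (ae_restrict_mem measurableSet_Icc),
      Measure.quasiMeasurePreserving_snd.ae huY, Measure.quasiMeasurePreserving_snd.ae hY']
      with p hp h1 h2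
    rw [h1 _ hp, h2 _ (hθT _ hp), hD _ hp]
  have hadm : IsAdmissible P lam T (fun t => demandInfo Y (θ t)) u := by
    refine ⟨memLp_two_prod_of_eLpNorm_le hum hK ?_, hu⟩
    filter_upwards [ae_restrict_mem measurableSet_Icc] with t ht
    rw [eLpNorm_congr_ae (hcond t ht)]
    exact (eLpNorm_condExp_le_eLpNorm _ one_le_two).trans (hKY _ (hτ t ht))
  exact ⟨isTheOptimalControl_of_condExp hlam hT hz₀
    (fun t ht => demandInfo_le hY.measurable (hθT t ht).2)
    (fun t ht => hY.memLp h hκ hμ (hτ t ht)) hK (fun t ht => hKY _ (hτ t ht)) hadm hcond, hcond⟩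

end

theorem IsDemand.ae_eq_initial {Ω : Type*} [MeasurableSpace Ω] {P : Measure Ω} {T κ σ y₀ γbar : ℝ}
    {ν : ℝ≥0} {μ : ℝ → ℝ} {W : ℝ≥0 → Ω → ℝ} {N : ℝ≥0 → Ω → ℕ} {γ : ℕ → Ω → ℝ} {Y : ℝ → Ω → ℝ}
    (hY : IsDemand P κ σ y₀ T μ W N γ Y)
    (h : IsDrivingNoise P W N γ ν γbar) (hT : 0 ≤ T) : ∀ᵐ ω ∂P, Y 0 ω = y₀ := by
  filter_upwards [hY.equation, h.brownian.eval_zero_ae_eq_zero, h.poisson.zero] with ω he hW hN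
  rw [he 0 ⟨le_rfl, hT⟩]
  simp [hW, hN]

theorem measurable_lastUpdate (Δ : ℝ) : Measurable (lastUpdate Δ) :=
  (measurable_from_nat.comp (Nat.measurable_floor.comp (measurable_id.div_const Δ))).mul_const Δ

theorem lastUpdate_mem_Icc {Δ t : ℝ} (hΔ : 0 < Δ) (ht : 0 ≤ t) : lastUpdate Δ t ∈ Icc 0 t :=
  ⟨mul_nonneg (Nat.cast_nonneg _) hΔ.le,
    (le_div_iff₀ hΔ).1 (Nat.floor_le (div_nonneg ht hΔ.le))⟩

end PowerDemand

theorem theorem3p2 {Ω : Type*} [MeasurableSpace Ω] (P : Measure Ω) [IsProbabilityMeasure P]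
    (κ σ lam T y₀ γbar : ℝ) (ν : ℝ≥0)
    (hκ : 0 < κ) (hσ : 0 < σ) (hlam : 0 < lam) (hν : 0 < ν) (hT : 1 / lam ≤ T)
    (μ : ℝ → ℝ) (hμ : IntegrableOn μ (Icc 0 T))
    (z₀ : ℝ → ℝ) (hz₀ : IntegrableOn z₀ (Ioo 0 1))
    (W : ℝ≥0 → Ω → ℝ) (N : ℝ≥0 → Ω → ℕ) (γ : ℕ → Ω → ℝ)
    (hnoise : IsDrivingNoise P W N γ ν γbar)
    (Y : ℝ → Ω → ℝ) (hY : IsDemand P κ σ y₀ T μ W N γ Y) :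
    -- the demand is square-integrable
    (∀ t ∈ Icc 0 T, MemLp (Y t) 2 P) ∧
    -- no updates
    (IsTheOptimalControl P lam T z₀ Y (fun _ => demandInfo Y 0)
        (controlNoUpdates κ lam ν γbar y₀ μ) ∧
      ∀ t ∈ Icc 0 (T - 1 / lam),
        controlNoUpdates κ lam ν γbar y₀ μ t =ᵐ[P] P[Y (t + 1 / lam) | demandInfo Y 0]) ∧
    -- updates at the times `0, Δ, 2Δ, …`
    (∀ Δ : ℝ, 0 < Δ →
      IsTheOptimalControl P lam T z₀ Y (fun t => demandInfo Y (lastUpdate Δ t))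
        (controlUpdates κ lam ν γbar Δ μ Y) ∧
      ∀ t ∈ Icc 0 (T - 1 / lam),
        controlUpdates κ lam ν γbar Δ μ Y t
          =ᵐ[P] P[Y (t + 1 / lam) | demandInfo Y (lastUpdate Δ t)]) ∧
    -- idealized setting
    (IsTheOptimalControl P lam T z₀ Y (fun t => demandInfo Y t)
        (controlIdealized κ lam ν γbar μ Y) ∧
      ∀ t ∈ Icc 0 (T - 1 / lam),
        controlIdealized κ lam ν γbar μ Y t =ᵐ[P] P[Y (t + 1 / lam) | demandInfo Y t]) := by
  have hT0 : 0 ≤ T := (by positivity : 0 ≤ 1 / lam).trans hT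
  refine ⟨fun t ht => hY.memLp hnoise hκ hμ ht, ?_, fun Δ hΔ => ?_, ?_⟩
  · refine hY.isTheOptimalControl_forecast hnoise hκ hlam hT hμ hz₀ (θ := fun _ => 0)
      measurable_const (fun t ht => ⟨le_rfl, ht.1⟩) (fun t _ => measurable_const) ?_
    filter_upwards [hY.ae_eq_initial hnoise hT0] with ω hω t _
    rw [hω, sub_zero]
    rfl
  · refine hY.isTheOptimalControl_forecast hnoise hκ hlam hT hμ hz₀ (measurable_lastUpdate Δ)
      (fun t ht => lastUpdate_mem_Icc hΔ ht.1) (fun t ht => ?_)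
      (Filter.Eventually.of_forall fun ω t _ => rfl)
    have hYθ := measurable_demandInfo Y (u := lastUpdate Δ t)
      ⟨(lastUpdate_mem_Icc hΔ ht.1).1, le_rfl⟩
    exact ((hYθ.const_mul _).add_const _).add_const _
  · refine hY.isTheOptimalControl_forecast hnoise hκ hlam hT hμ hz₀ (θ := fun t => t)
      measurable_id (fun t ht => ⟨ht.1, le_rfl⟩) (fun t ht => ?_)
      (Filter.Eventually.of_forall fun ω t _ => ?_)
    · have hYt := measurable_demandInfo Y (u := t) ⟨ht.1, le_rfl⟩
      exact ((hYt.const_mul _).add_const _).add_const _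
    · have hexp : -κ * (t + 1 / lam - t) = -κ / lam := by ring
      rw [hexp]
      rfl
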